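/- Let $r\ge 1$. Let $\mathcal C$ be the Hankel contour: it runs along the top side of the real axis from $+\infty$ to $\epsilon$, once counterclockwise around the circle $|x|=\epsilon$, and back along the bottom side of the real axis from $\epsilon$ to $+\infty$, where $\epsilon>0$ is small in the sense that $r\epsilon<1$; on $\mathcal C$ the powers $x^{s-1}$ are taken with $\arg x$ running continuously from $0$ to $2\pi$. Write $y_j:=x_j+x_{j+1}+\cdots+x_r$ for $1\le j\le r$, and $$C(s_1,\dots,s_r):=\prod_{k=1}^r\frac{1}{(e^{2\pi i s_k}-1)\,\Gamma(s_k)} .$$ For $0<t<1$ and $s_1,\dots,s_r\in\mathbb C\setminus\mathbb Z$ put $$\hat\zeta^{\rm des}_r(s_1,\dots,s_r)(t):=C(s_1,\dots,s_r)\int_{\mathcal C^r}\prod_{j=1}^r\left(\frac{1}{\frac1t e^{y_j}-1}+\frac{(\log t-y_j)\,\frac1t e^{y_j}}{\left(\frac1t e^{y_j}-1\right)^2}\right)\prod_{k=1}^r x_k^{s_k-1}\,dx_k .$$ For $s_1,\dots,s_r\in\mathbb C\setminus\mathbb Z$, the desingularized multiple zeta function is $$\zeta^{\rm des}_r(s_1,\dots,s_r):=\lim_{\substack{c\to1\\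 c\in\mathbb R,\ c\neq1}}\frac{1}{(1-c)^r}\,C(s_1,\dots,s_r)\int_{\mathcal C^r}\prod_{j=1}^r\left(\frac{1}{e^{y_j}-1}-\frac{c}{e^{c y_j}-1}\right)\prod_{k=1}^r x_k^{s_k-1}\,dx_k .$$ (The removable singularities of the integrands at $y_j=\log t$, respectively $y_j=0$, are filled by the limit values $-\frac12$, respectively $\frac{c-1}{2}$.) **Proposition.** 1. For every $t\in(0,1)$, the integral defining $\hat\zeta^{\rm des}_r(s_1,\dots,s_r)(t)$ converges absolutely for all $s_1,\dots,s_r\in\mathbb C\setminus\mathbb Z$ and all $\epsilon>0$ with $r\epsilon<1$, its value does not depend on $\epsilon$, and $\hat\zeta^{\rm des}_r(s_1,\dots,s_r)(t)$ continues analytically to an entire function of $(s_1,\dots,s_r)\in\mathbb C^r$. 2. Likewise, for all $s_1,\dots,s_r\in\mathbb C\setminus\mathbb Z$ and all $\epsilon>0$ with $r\epsilon<1$, the integrals in the definition of $\zeta^{\rm des}_r(s_1,\dots,s_r)$ converge absolutely for $c$ near $1$, $c\ne 1$, the limit exists and does not depend on $\epsilon$, and $\zeta^{\rm des}_r$ continues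 analytically to an entire function on $\mathbb C^r$. 3. For the functions so continued, and for every $(s_1,\dots,s_r)\in\mathbb C^r$, $$\lim_{t\to1-0}\hat\zeta^{\rm des}_r(s_1,\dots,s_r)(t)=\zeta^{\rm des}_r(s_1,\dots,s_r).$$ -/

import Mathlib

namespace DesMZF

/-- Modulus of the point with parameter `u` on the Hankel contour of radius `ε`: the parameter
range `u ≤ 0` is the top side of `[ε, ∞)` (run from `+∞` to `ε`), `0 ≤ u ≤ 2π` is the circle
(run counterclockwise), and `2π ≤ u` is the bottom side of `[ε, ∞)` (run from `ε` to `+∞`). -/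
noncomputable def hankelRadius (ε u : ℝ) : ℝ :=
  if u < 0 then ε - u else if u ≤ 2 * Real.pi then ε else ε + (u - 2 * Real.pi)

/-- Argument along the Hankel contour: `0` on the top side, increasing from `0` to `2π` on the
circle, `2π` on the bottom side. -/
noncomputable def hankelArg (u : ℝ) : ℝ :=
  if u < 0 then 0 else if u ≤ 2 * Real.pi then u else 2 * Real.pi

/-- The parametrised Hankel contour. -/
noncomputable def hankelPoint (ε u : ℝ) : ℂ :=
  (hankelRadius ε u : ℂ) * Complex.exp (Complex.I * (hankelArg u : ℂ))

/-- Derivative in `u` of `hankelPoint ε u` (away from the two corners `u = 0` and `u = 2π`). -/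
noncomputable def hankelVelocity (ε u : ℝ) : ℂ :=
  if u < 0 then -1
  else if u ≤ 2 * Real.pi then Complex.I * (ε : ℂ) * Complex.exp (Complex.I * (u : ℂ))
  else 1

/-- The power `x ^ w = exp (w (log |x| + i arg x))` at `x = hankelPoint ε u`, with the argument
that varies continuously from `0` to `2π` along the contour. -/
noncomputable def hankelPow (ε u : ℝ) (w : ℂ) : ℂ :=
  Complex.exp (w * ((Real.log (hankelRadius ε u) : ℂ) + Complex.I * (hankelArg u : ℂ)))

/-- The pulled-back integrand, at the parameters `u₁, …, u_r`, of
`∫_{C^r} ∏ⱼ K (xⱼ + ⋯ + x_r) ∏ₖ xₖ ^ (sₖ - 1) dxₖ`. -/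
noncomputable def hankelIntegrand (r : ℕ) (K : ℂ → ℂ) (ε : ℝ) (s : Fin r → ℂ)
    (u : Fin r → ℝ) : ℂ :=
  (∏ j : Fin r, K (∑ k ∈ Finset.Ici j, hankelPoint ε (u k))) *
    ∏ k : Fin r, (hankelPow ε (u k) (s k - 1) * hankelVelocity ε (u k))

/-- The `r`-fold contour integral `∫_{C^r} ∏ⱼ K (xⱼ + ⋯ + x_r) ∏ₖ xₖ ^ (sₖ - 1) dxₖ` over the
Hankel contour `C` of radius `ε`. -/
noncomputable def hankelIntegral (r : ℕ) (K : ℂ → ℂ) (ε : ℝ) (s : Fin r → ℂ) : ℂ :=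
  ∫ u : Fin r → ℝ, hankelIntegrand r K ε s u

/-- The factor `C(s) = ∏ₖ 1 / ((e ^ (2 π i sₖ) - 1) Γ(sₖ))`. -/
noncomputable def hankelFactor (r : ℕ) (s : Fin r → ℂ) : ℂ :=
  ∏ k : Fin r, 1 / ((Complex.exp (2 * (Real.pi : ℂ) * Complex.I * s k) - 1) * Complex.Gamma (s k))

/-- The kernel `1 / (e ^ y - 1) - c / (e ^ (c y) - 1)`, with the removable singularity at `y = 0`
filled by its limit `(c - 1) / 2`, the constant term of `∑_{m ≥ 1} (1 - c ^ m) B_m y ^ (m - 1) / m!`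
(with `B_1 = -1/2`). -/
noncomputable def desKernel (c : ℝ) (y : ℂ) : ℂ :=
  if y = 0 then ((c : ℂ) - 1) / 2
  else 1 / (Complex.exp y - 1) - (c : ℂ) / (Complex.exp ((c : ℂ) * y) - 1)

/-- The kernel `1 / (t⁻¹ e ^ y - 1) + (log t - y) t⁻¹ e ^ y / (t⁻¹ e ^ y - 1) ^ 2`, with the
removable singularity at `y = log t` filled by its limit `-1 / 2`. -/
noncomputable def hatKernel (t : ℝ) (y : ℂ) : ℂ :=
  if y = (Real.log t : ℂ) then -1 / 2
  else 1 / (1 / (t : ℂ) * Complex.exp y - 1) +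
    (((Real.log t : ℂ) - y) * (1 / (t : ℂ)) * Complex.exp y) /
      (1 / (t : ℂ) * Complex.exp y - 1) ^ 2

/-- All coordinates of `s` lie in `ℂ ∖ ℤ`. -/
def NonInteger {r : ℕ} (s : Fin r → ℂ) : Prop :=
  ∀ (k : Fin r) (n : ℤ), s k ≠ (n : ℂ)

/-- The radius of the circle in the Hankel contour is sufficiently small for `r`-fold integrals:
sums of at most `r` points of the contour then lie in `{|z| < 1}` or in a sector
`{|arg z| ≤ θ}` with `θ < π / 2`. -/
def SmallRadius (r : ℕ) (ε : ℝ) : Prop :=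
  0 < ε ∧ (r : ℝ) * ε < 1

/-- `Z` is the desingularized multiple zeta function of depth `r` on `ℂ ^ r`: it is entire, and on
`(ℂ ∖ ℤ) ^ r` it is the limit, as the real number `c ≠ 1` tends to `1`, of
`(1 - c) ^ (-r) C(s) ∫_{C^r} ∏ⱼ (1 / (e ^ yⱼ - 1) - c / (e ^ (c yⱼ) - 1)) ∏ₖ xₖ ^ (sₖ - 1) dxₖ`,
where `yⱼ = xⱼ + ⋯ + x_r`; the integrals converge absolutely for `c` near `1`. As `(ℂ ∖ ℤ) ^ r` is
dense, at most one `Z` has this property. -/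
def IsDesZeta (r : ℕ) (Z : (Fin r → ℂ) → ℂ) : Prop :=
  Differentiable ℂ Z ∧
    ∀ ε : ℝ, SmallRadius r ε → ∀ s : Fin r → ℂ, NonInteger s →
      (∀ᶠ c in nhdsWithin (1 : ℝ) {1}ᶜ,
        MeasureTheory.Integrable (hankelIntegrand r (desKernel c) ε s)) ∧
      Filter.Tendsto
        (fun c : ℝ =>
          1 / (1 - (c : ℂ)) ^ r * (hankelFactor r s * hankelIntegral r (desKernel c) ε s))
        (nhdsWithin (1 : ℝ) {1}ᶜ) (nhds (Z s))

/-- `Z` is the entire continuation to `ℂ ^ r` of the one-parameter desingularized multiple zeta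
function at `t`, which on `(ℂ ∖ ℤ) ^ r` is given by an absolutely convergent Hankel integral. As
`(ℂ ∖ ℤ) ^ r` is dense, at most one `Z` has this property. -/
def IsHatDesZeta (r : ℕ) (t : ℝ) (Z : (Fin r → ℂ) → ℂ) : Prop :=
  Differentiable ℂ Z ∧
    ∀ ε : ℝ, SmallRadius r ε → ∀ s : Fin r → ℂ, NonInteger s →
      MeasureTheory.Integrable (hankelIntegrand r (hatKernel t) ε s) ∧
      Z s = hankelFactor r s * hankelIntegral r (hatKernel t) ε s

end DesMZF

namespace DesMZF

open Complex MeasureTheory Set Filter Topology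

/-! Both kernels come from g(w) = w/(e^w - 1) and B = g'. With a = -log t, the kernel of the
t-deformation is B(y + a) (`hatKernel_eq`). The other kernel is (g(y) - g(cy))/y, so divided by 1 -
c it tends to B(y) (`tendsto_desKernel_div`). Everything reduces to Hankel integrals of ∏ B(y_j + a)
with a ≥ 0.

The substitution u = σ(t) in the Beta integral B(1+z, 1-z), with Euler's reflection formula, writes
g, and after differentiation B, as a superposition of exponentials e^{-αw} with α on the line Re α =
1/2 and exponentially decaying density (`integral_exp_frequency`, `integral_exp_mul_kernelDensity`).
Since ∑ α_j y_j = ∑ A_k x_k with A_k = α_1 + ⋯ + α_k, the variables x_k decouple. Fubini and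
Hankel's formula (`integral_exp_mul_hankelWeight`) turn each one into (e^{2πis_k} - 1) Γ(s_k)
A_k^{-s_k}, and the prefactor C(s) cancels exactly.

What remains is `entireZeta`, the integral of ∏ A_k^{-s_k} against the density (`entireZeta_eq`). It
does not involve ε. As Re A_k ≥ 1/2, the powers cost at most e^{|s_k| |log A_k|}, which the
exponential decay absorbs for every s, so the integral is entire. The majorant is independent of a ≥
0, so dominated convergence gives the limit a → 0+ for every s, integers included
(`tendsto_entireZeta`). The limit c → 1 is a second dominated convergence, on the contour itself
(`isDesZeta_entireZeta`). -/

/-! ### Logistic density and the Beta integral -/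

/-- The density of the logistic distribution. -/
noncomputable def logisticDensity (t : ℝ) : ℝ :=
  Real.sigmoid t * (1 - Real.sigmoid t)

/-- The line `Re = 1 / 2`, over which exponentials are superposed. -/
noncomputable def frequency (t : ℝ) : ℂ := 1 / 2 + (t / (2 * Real.pi) : ℝ) * I

@[fun_prop]
lemma continuous_frequency : Continuous frequency := by
  unfold frequency; fun_prop

@[fun_prop]
lemma continuous_logisticDensity : Continuous logisticDensity := by
  unfold logisticDensity
  have := continuous_sigmoid
  fun_prop

lemma frequency_re (t : ℝ) : (frequency t).re = 1 / 2 := by simp [frequency, -ofReal_div]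

lemma frequency_im (t : ℝ) : (frequency t).im = t / (2 * Real.pi) := by
  simp [frequency, -ofReal_div]

lemma logisticDensity_nonneg (t : ℝ) : 0 ≤ logisticDensity t :=
  mul_nonneg (Real.sigmoid_nonneg t) (by linarith [Real.sigmoid_le_one t])

lemma logisticDensity_le (t : ℝ) : logisticDensity t ≤ Real.exp (-|t|) := by
  have key : ∀ x : ℝ, Real.sigmoid x ≤ Real.exp x := fun x => by
    rw [Real.sigmoid_def]
    rw [inv_le_comm₀ (by positivity) (by positivity), ← Real.exp_neg]
    linarith
  unfold logisticDensity
  rcases le_total 0 t with h | h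
  · rw [abs_of_nonneg h, ← Real.sigmoid_neg]
    have := key (-t)
    nlinarith [Real.sigmoid_le_one t, Real.sigmoid_nonneg t, Real.sigmoid_nonneg (-t)]
  · rw [abs_of_nonpos h, neg_neg, ← Real.sigmoid_neg]
    have := key t
    nlinarith [Real.sigmoid_le_one (-t), Real.sigmoid_nonneg t, Real.sigmoid_nonneg (-t)]

lemma norm_frequency_le (t : ℝ) : ‖frequency t‖ ≤ 1 / 2 + |t| / 6 := by
  unfold frequency
  refine (norm_add_le _ _).trans ?_
  have h : ‖((t / (2 * Real.pi) : ℝ) : ℂ) * I‖ = |t| / (2 * Real.pi) := by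
    rw [norm_mul, norm_I, mul_one, Complex.norm_real, Real.norm_eq_abs, abs_div,
      abs_of_pos (by positivity : (0:ℝ) < 2 * Real.pi)]
  rw [h]
  have : |t| / (2 * Real.pi) ≤ |t| / 6 := by
    gcongr; linarith [Real.pi_gt_three]
  norm_num
  linarith

/-- Budget of exponents: the strip |Im w| ≤ 2 costs e^{|t|/3} because π > 3, and a factor `frequency
t` will cost e^{|t|/6}; against e^{-|t|} this leaves e^{-|t|/2}. -/
lemma norm_exp_frequency_le {w : ℂ} (hw : |w.im| ≤ 2) (t : ℝ) :
    ‖exp (-(frequency t) * w)‖ ≤ Real.exp (-w.re / 2) * Real.exp (|t| / 3) := by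
  rw [Complex.norm_exp, ← Real.exp_add]
  apply Real.exp_le_exp.mpr
  simp only [mul_re, neg_re, neg_im, frequency_re, frequency_im]
  have h1 : t / (2 * Real.pi) * w.im ≤ |t| / 3 := by
    calc t / (2 * Real.pi) * w.im ≤ |t / (2 * Real.pi) * w.im| := le_abs_self _
      _ = |t| / (2 * Real.pi) * |w.im| := by
        rw [abs_mul, abs_div, abs_of_pos (by positivity : (0:ℝ) < 2 * Real.pi)]
      _ ≤ |t| / 6 * 2 := by
        gcongr; linarith [Real.pi_gt_three]
      _ = _ := by ring
  linarith

lemma integrable_exp_neg_mul_abs {c : ℝ} (hc : 0 < c) :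
    Integrable (fun t : ℝ => Real.exp (-c * |t|)) := by
  rw [← integrableOn_univ, ← Iic_union_Ioi (a := (0:ℝ)), integrableOn_union]
  constructor
  · refine (integrableOn_exp_mul_Iic hc 0).congr_fun (fun t ht => ?_) measurableSet_Iic
    simp only [abs_of_nonpos (mem_Iic.mp ht)]; ring_nf
  · refine (exp_neg_integrableOn_Ioi 0 hc).congr_fun (fun t ht => ?_) measurableSet_Ioi
    simp only [abs_of_pos (mem_Ioi.mp ht)]

lemma log_sigmoid_sub (t : ℝ) :
    Real.log (Real.sigmoid t) - Real.log (1 - Real.sigmoid t) = t := by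
  have h := Real.sigmoid_mul_rexp_neg t
  rw [Real.sigmoid_neg] at h
  rw [← h, Real.log_mul (Real.sigmoid_pos t).ne' (Real.exp_pos _).ne', Real.log_exp]
  ring

/-- Substitute u = σ(t) in the Beta integral of u^z (1-u)^{-z}: the Jacobian is the density, and log
u - log(1-u) = t. -/
lemma integral_exp_mul_logisticDensity {z : ℂ} (h1 : |z.re| < 1) :
    ∫ t : ℝ, exp (t * z) * logisticDensity t = Gamma (1 + z) * Gamma (1 - z) := by
  have hB := Gamma_mul_Gamma_eq_betaIntegral (s := 1 + z) (t := 1 - z)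
    (by simp; linarith [abs_lt.mp h1]) (by simp; linarith [abs_lt.mp h1])
  rw [hB, show 1 + z + (1 - z) = 1 + 1 by ring, Complex.Gamma_add_one 1 one_ne_zero,
    Complex.Gamma_one, betaIntegral, intervalIntegral.integral_of_le zero_le_one,
    integral_Ioc_eq_integral_Ioo, ← Real.range_sigmoid, ← image_univ,
    integral_image_eq_integral_abs_deriv_smul MeasurableSet.univ
      (fun x _ => (Real.hasDerivAt_sigmoid x).hasDerivWithinAt) Real.sigmoid_injective.injOn,
    one_mul, one_mul, setIntegral_univ]
  refine integral_congr_ae (ae_of_all _ fun t => ?_)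
  have h0 := Real.sigmoid_pos t
  have h2 : 0 < 1 - Real.sigmoid t := by linarith [Real.sigmoid_lt_one t]
  simp only [real_smul]
  rw [← logisticDensity, abs_of_nonneg (logisticDensity_nonneg t), ← ofReal_one, ← ofReal_sub,
    cpow_def_of_ne_zero (ofReal_ne_zero.mpr h0.ne'),
    cpow_def_of_ne_zero (ofReal_ne_zero.mpr h2.ne'), ← ofReal_log h0.le, ← ofReal_log h2.le,
    ← Complex.exp_add, mul_comm (exp _)]
  unfold logisticDensity
  congr 2
  nth_rw 1 [← log_sigmoid_sub t]
  push_cast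
  ring

/-! ### The Bernoulli generating function as a superposition of exponentials -/

/-- The function `w / (e ^ w - 1)`. -/
noncomputable def bernoulliGen (w : ℂ) : ℂ := if w = 0 then 1 else w / (exp w - 1)

/-- The derivative of `w / (e ^ w - 1)`. -/
noncomputable def bernoulliKernel (w : ℂ) : ℂ :=
  if w = 0 then -1 / 2 else 1 / (exp w - 1) - w * exp w / (exp w - 1) ^ 2

lemma exp_ne_one_of_abs_im_lt {w : ℂ} (h0 : w ≠ 0) (hw : |w.im| < 2 * Real.pi) :
    exp w ≠ 1 := by
  intro h
  obtain ⟨n, hn⟩ := Complex.exp_eq_one_iff.mp h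
  have him : w.im = n * (2 * Real.pi) := by rw [hn]; simp
  rw [him, abs_mul, abs_of_pos (by positivity : (0:ℝ) < 2 * Real.pi)] at hw
  have hn1 : |(n : ℝ)| < 1 := by
    by_contra hc
    push Not at hc
    nlinarith [Real.pi_pos]
  have hn0 : n = 0 := by
    rw [← Int.cast_abs] at hn1
    exact Int.abs_lt_one_iff.mp (by exact_mod_cast hn1)
  apply h0
  rw [hn, hn0]; simp

lemma integral_exp_frequency {w : ℂ} (hw : |w.im| < 2 * Real.pi) :
    ∫ t : ℝ, exp (-(frequency t) * w) * logisticDensity t = bernoulliGen w := by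
  -- With this z, e^{-αw} = e^{-w/2} e^{tz}, and |Im w| < 2π becomes |Re z| < 1. Reflection gives πz
  -- / sin πz = (w/2) / sinh(w/2).
  set z : ℂ := -I * w / (2 * Real.pi) with hz
  have hpi : (Real.pi : ℂ) ≠ 0 := ofReal_ne_zero.mpr Real.pi_ne_zero
  have hre : z.re = w.im / (2 * Real.pi) := by
    have : z = ((1 / (2 * Real.pi) : ℝ) : ℂ) * (-I * w) := by
      rw [hz]; push_cast; field_simp
    rw [this, re_ofReal_mul]
    simp
    ring
  have h1 : |z.re| < 1 := by
    rw [hre, abs_div, abs_of_pos (by positivity : (0:ℝ) < 2 * Real.pi),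
      div_lt_one (by positivity)]
    exact hw
  have hint : ∫ t : ℝ, exp (-(frequency t) * w) * logisticDensity t =
      exp (-w / 2) * (Gamma (1 + z) * Gamma (1 - z)) := by
    rw [← integral_exp_mul_logisticDensity h1, ← integral_const_mul]
    refine integral_congr_ae (ae_of_all _ fun t => ?_)
    simp only [← mul_assoc, ← Complex.exp_add]
    congr 2
    rw [hz, frequency]
    push_cast
    field_simp
    ring
  rw [hint, bernoulliGen]
  split_ifs with h0
  · simp [hz, h0]
  · have hz0 : z ≠ 0 := by
      rw [hz]
      exact div_ne_zero (mul_ne_zero (neg_ne_zero.mpr I_ne_zero) h0)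
        (mul_ne_zero two_ne_zero hpi)
    rw [add_comm 1 z, Gamma_add_one z hz0, mul_assoc, Complex.Gamma_mul_Gamma_one_sub]
    have hne := sub_ne_zero.mpr (exp_ne_one_of_abs_im_lt h0 hw)
    have hs : sin (Real.pi * z) = (exp (-w / 2) - exp (w / 2)) * I / 2 := by
      have e1 : -(Real.pi * z) * I = -w / 2 := by
        rw [hz]; field_simp; rw [I_sq]
      have e2 : Real.pi * z * I = w / 2 := by
        rw [hz]; field_simp; rw [I_sq]; ring
      rw [Complex.sin, e1, e2]
    have e3 : exp w = exp (w / 2) * exp (w / 2) := by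
      rw [← Complex.exp_add]; ring_nf
    have e4 : exp (-w / 2) * exp (w / 2) = 1 := by
      rw [← Complex.exp_add]; ring_nf; simp
    have e5 : exp (-w / 2) * (exp w - 1) = exp (w / 2) - exp (-w / 2) := by
      rw [e3]; linear_combination exp (w / 2) * e4
    have hne2 : exp (-w / 2) - exp (w / 2) ≠ 0 := by
      rw [← neg_sub, neg_ne_zero, ← e5]
      exact mul_ne_zero (Complex.exp_ne_zero _) hne
    have e6 : -I * w / (2 * Real.pi) * (Real.pi / ((exp (-w / 2) - exp (w / 2)) * I / 2)) =
        -w / (exp (-w / 2) - exp (w / 2)) := by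
      field_simp
    rw [hs, hz, e6, mul_div_assoc', div_eq_div_iff hne2 hne]
    linear_combination (-w) * e5

lemma norm_frequency_mul_logisticDensity_le (t : ℝ) :
    ‖frequency t‖ * logisticDensity t ≤ Real.exp (-|t| * (5 / 6)) := by
  have h1 : ‖frequency t‖ ≤ Real.exp (|t| / 6) := by
    linarith [norm_frequency_le t, Real.add_one_le_exp (|t| / 6)]
  calc _ ≤ Real.exp (|t| / 6) * Real.exp (-|t|) :=
        mul_le_mul h1 (logisticDensity_le t) (logisticDensity_nonneg t) (Real.exp_pos _).le
    _ = _ := by rw [← Real.exp_add]; ring_nf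

/-- The density of the superposition `∫ e ^ (-α w)` that represents `bernoulliKernel`. -/
noncomputable def kernelDensity (t : ℝ) : ℂ := -(frequency t) * logisticDensity t

@[fun_prop]
lemma continuous_kernelDensity : Continuous kernelDensity := by
  unfold kernelDensity; fun_prop

lemma norm_kernelDensity_le (t : ℝ) : ‖kernelDensity t‖ ≤ Real.exp (-|t| * (5 / 6)) := by
  rw [kernelDensity, norm_mul, norm_neg, Complex.norm_real, Real.norm_of_nonneg
    (logisticDensity_nonneg t)]
  exact norm_frequency_mul_logisticDensity_le t

lemma norm_exp_mul_kernelDensity_le {w : ℂ} (hw : |w.im| ≤ 2) (t : ℝ) :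
    ‖exp (-(frequency t) * w) * kernelDensity t‖ ≤
      Real.exp (-w.re / 2) * Real.exp (-(1 / 2) * |t|) := by
  rw [norm_mul]
  calc _ ≤ (Real.exp (-w.re / 2) * Real.exp (|t| / 3)) * Real.exp (-|t| * (5 / 6)) := by
        gcongr
        · exact norm_exp_frequency_le hw t
        · exact norm_kernelDensity_le t
    _ = _ := by rw [mul_assoc, ← Real.exp_add]; ring_nf

lemma integrable_exp_mul_kernelDensity {w : ℂ} (hw : |w.im| ≤ 2) :
    Integrable (fun t : ℝ => exp (-(frequency t) * w) * kernelDensity t) := by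
  refine ((integrable_exp_neg_mul_abs (c := 1 / 2) (by norm_num)).const_mul
    (Real.exp (-w.re / 2))).mono' (Continuous.aestronglyMeasurable (by fun_prop))
    (ae_of_all _ fun t => norm_exp_mul_kernelDensity_le hw t)

/-- Differentiation under the integral sign; restricting to Re v > Re w - 1 makes the majorant
uniform in v. -/
lemma hasDerivAt_bernoulliGen_integral {w : ℂ} (hw : |w.im| < 2) :
    HasDerivAt bernoulliGen (∫ t : ℝ, exp (-(frequency t) * w) * kernelDensity t) w := by
  have hpi := Real.pi_gt_three
  have hopen : IsOpen {v : ℂ | |v.im| < 2 ∧ w.re - 1 < v.re} :=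
    (isOpen_lt (continuous_im.abs) continuous_const).inter
      (isOpen_lt continuous_const continuous_re)
  have hmem : {v : ℂ | |v.im| < 2 ∧ w.re - 1 < v.re} ∈ 𝓝 w :=
    hopen.mem_nhds ⟨hw, by linarith⟩
  have key := (hasDerivAt_integral_of_dominated_loc_of_deriv_le (μ := volume)
    (F := fun (v : ℂ) (t : ℝ) => exp (-(frequency t) * v) * logisticDensity t)
    (F' := fun (v : ℂ) (t : ℝ) => exp (-(frequency t) * v) * kernelDensity t)
    (bound := fun t => Real.exp (-(w.re - 1) / 2) * Real.exp (-(1 / 2) * |t|)) hmem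
    (Eventually.of_forall fun v => Continuous.aestronglyMeasurable (by fun_prop)) ?_
    (Continuous.aestronglyMeasurable (by fun_prop)) (ae_of_all _ fun t v hv => ?_)
    ((integrable_exp_neg_mul_abs (by norm_num)).const_mul _) (ae_of_all _ fun t v hv => ?_)).2
  · refine key.congr_of_eventuallyEq ?_
    filter_upwards [hmem] with v hv
    exact (integral_exp_frequency (by linarith [hv.1])).symm
  · refine ((integrable_exp_neg_mul_abs (c := 1 / 2) (by norm_num)).const_mul
      (Real.exp (-w.re / 2))).mono' (Continuous.aestronglyMeasurable (by fun_prop))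
      (ae_of_all _ fun t => ?_)
    rw [norm_mul, Complex.norm_real, Real.norm_of_nonneg (logisticDensity_nonneg t)]
    calc _ ≤ (Real.exp (-w.re / 2) * Real.exp (|t| / 3)) * Real.exp (-|t|) := by
          gcongr
          · exact logisticDensity_nonneg t
          · exact norm_exp_frequency_le hw.le t
          · exact logisticDensity_le t
      _ ≤ _ := by
          rw [mul_assoc, ← Real.exp_add]
          gcongr
          linarith [abs_nonneg t]
  · refine (norm_exp_mul_kernelDensity_le hv.1.le t).trans ?_
    gcongr
    exact hv.2.le
  · have := ((((hasDerivAt_id v).const_mul (-(frequency t))).cexp).mul_const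
      (logisticDensity t : ℂ))
    refine this.congr_deriv ?_
    simp only [id, kernelDensity]
    ring

lemma integral_exp_mul_kernelDensity {w : ℂ} (hw : |w.im| < 2) :
    ∫ t : ℝ, exp (-(frequency t) * w) * kernelDensity t = bernoulliKernel w := by
  rw [bernoulliKernel]
  split_ifs with h0
  · have h1 := integral_exp_frequency (w := 0) (by simp [Real.pi_pos])
    simp only [mul_zero, Complex.exp_zero, one_mul, bernoulliGen, if_true] at h1
    have hint := integrable_exp_mul_kernelDensity (w := 0) (by simp)
    -- The quotient rule fails at w = 0. Symmetry replaces it: the density is even and opposite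
    -- frequencies add up to 1, so twice the integral is -g(0) = -1.
    have hneg : ∀ t, frequency (-t) + frequency t = 1 := fun t => by
      unfold frequency; push_cast; ring
    have hev : ∀ t, logisticDensity (-t) = logisticDensity t := fun t => by
      unfold logisticDensity; rw [Real.sigmoid_neg]; ring
    simp only [h0, mul_zero, Complex.exp_zero, one_mul] at hint ⊢
    have h2 : ∫ t, (kernelDensity (-t) + kernelDensity t) = -1 := by
      rw [← h1, ← integral_neg]
      refine integral_congr_ae (ae_of_all _ fun t => ?_)
      simp only [kernelDensity, hev]
      linear_combination -(logisticDensity t : ℂ) * hneg t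
    rw [integral_add hint.comp_neg hint, integral_neg_eq_self] at h2
    linear_combination h2 / 2
  · have hpi := Real.pi_gt_three
    have hne := sub_ne_zero.mpr (exp_ne_one_of_abs_im_lt h0 (by linarith))
    have hd : HasDerivAt (fun v : ℂ => v / (exp v - 1))
        ((1 * (exp w - 1) - w * exp w) / (exp w - 1) ^ 2) w :=
      (hasDerivAt_id w).div ((Complex.hasDerivAt_exp w).sub_const 1) hne
    have hd2 := hd.congr_of_eventuallyEq (f₁ := bernoulliGen) (by
      filter_upwards [isOpen_ne.mem_nhds h0] with v hv
      exact if_neg hv)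
    rw [(hasDerivAt_bernoulliGen_integral hw).unique hd2]
    field_simp

lemma hasDerivAt_bernoulliGen {w : ℂ} (hw : |w.im| < 2) :
    HasDerivAt bernoulliGen (bernoulliKernel w) w :=
  integral_exp_mul_kernelDensity hw ▸ hasDerivAt_bernoulliGen_integral hw

lemma exists_norm_bernoulliKernel_le :
    ∃ M : ℝ, 0 < M ∧ ∀ w : ℂ, |w.im| < 2 → ‖bernoulliKernel w‖ ≤ M * Real.exp (-w.re / 2) := by
  refine ⟨∫ t : ℝ, Real.exp (-(1 / 2) * |t|), integral_exp_pos
    (integrable_exp_neg_mul_abs (by norm_num)), fun w hw => ?_⟩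
  rw [← integral_exp_mul_kernelDensity hw, mul_comm, ← integral_const_mul]
  exact norm_integral_le_of_norm_le
    ((integrable_exp_neg_mul_abs (by norm_num)).const_mul _)
    (ae_of_all _ fun t => norm_exp_mul_kernelDensity_le hw.le t)

/-! ### Gamma integrals with a complex rate -/

lemma integrableOn_Ioi_rpow_mul_exp_neg {ε κ : ℝ} (hε : 0 < ε) (hκ : 0 < κ) (σ : ℝ) :
    IntegrableOn (fun x : ℝ => x ^ σ * Real.exp (-κ * x)) (Ioi ε) := by
  refine integrable_of_isBigO_exp_neg (b := κ / 2) (by positivity) ?_ ?_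
  · intro x hx
    have hx0 : x ≠ 0 := (hε.trans_le hx).ne'
    exact ((Real.continuousAt_rpow_const x σ (Or.inl hx0)).mul
      (by fun_prop)).continuousWithinAt
  · have h := (isLittleO_rpow_exp_pos_mul_atTop σ (b := κ / 2) (by positivity)).isBigO
    have h2 := h.mul (Asymptotics.isBigO_refl (fun x : ℝ => Real.exp (-κ * x)) atTop)
    refine h2.congr_right fun x => ?_
    rw [← Real.exp_add]; ring_nf

lemma integrableOn_Ioi_zero_rpow_mul_exp_neg {κ σ : ℝ} (hκ : 0 < κ) (hσ : -1 < σ) :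
    IntegrableOn (fun x : ℝ => x ^ σ * Real.exp (-κ * x)) (Ioi 0) := by
  simpa using integrableOn_rpow_mul_exp_neg_mul_rpow hσ one_pos hκ

lemma norm_cpow_mul_exp_neg {x : ℝ} (hx : 0 < x) (s α : ℂ) :
    ‖(x : ℂ) ^ s * exp (-α * x)‖ = x ^ s.re * Real.exp (-α.re * x) := by
  rw [norm_mul, Complex.norm_cpow_eq_rpow_re_of_pos hx, Complex.norm_exp]
  simp

lemma continuousOn_cpow_mul_exp_neg (s α : ℂ) :
    ContinuousOn (fun x : ℝ => (x : ℂ) ^ s * exp (-α * x)) (Ioi 0) := by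
  intro x hx
  exact ((continuousAt_ofReal_cpow_const x s (Or.inr (ne_of_gt hx))).mul
    (by fun_prop)).continuousWithinAt

lemma integrableOn_Ioi_cpow_mul_exp_neg {ε : ℝ} {α : ℂ} (hε : 0 < ε) (hα : 0 < α.re) (s : ℂ) :
    IntegrableOn (fun x : ℝ => (x : ℂ) ^ s * exp (-α * x)) (Ioi ε) := by
  refine (integrableOn_Ioi_rpow_mul_exp_neg hε hα s.re).mono'
    (((continuousOn_cpow_mul_exp_neg s α).mono (Ioi_subset_Ioi hε.le)).aestronglyMeasurable
      measurableSet_Ioi) ?_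
  filter_upwards [ae_restrict_mem measurableSet_Ioi] with x hx
  exact (norm_cpow_mul_exp_neg (hε.trans hx) s α).le

lemma integrableOn_Ioi_zero_cpow_mul_exp_neg {α s : ℂ} (hα : 0 < α.re) (hs : -1 < s.re) :
    IntegrableOn (fun x : ℝ => (x : ℂ) ^ s * exp (-α * x)) (Ioi 0) := by
  refine (integrableOn_Ioi_zero_rpow_mul_exp_neg hα hs).mono'
    ((continuousOn_cpow_mul_exp_neg s α).aestronglyMeasurable measurableSet_Ioi) ?_
  filter_upwards [ae_restrict_mem measurableSet_Ioi] with x hx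
  exact (norm_cpow_mul_exp_neg hx s α).le

/-- The Mellin transform of `e ^ (-α x)` for complex `α` of positive real part. -/
lemma integral_cpow_mul_exp_neg_mul_complex {α s : ℂ} (hα : 0 < α.re) (hs : 0 < s.re) :
    ∫ x in Ioi (0 : ℝ), (x : ℂ) ^ (s - 1) * exp (-α * x) = Gamma s * α ^ (-s) := by
  have hopen : IsOpen {v : ℂ | 0 < v.re} := isOpen_lt continuous_const continuous_re
  have hF : DifferentiableOn ℂ (fun v : ℂ => ∫ x in Ioi (0 : ℝ), (x : ℂ) ^ (s - 1) * exp (-v * x))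
      {v : ℂ | 0 < v.re} := by
    intro v hv
    have hv0 : 0 < v.re := hv
    have hmem : {z : ℂ | v.re / 2 < z.re} ∈ 𝓝 v :=
      (isOpen_lt continuous_const continuous_re).mem_nhds (by simp only [mem_ofPred_eq]; linarith)
    refine DifferentiableAt.differentiableWithinAt (HasDerivAt.differentiableAt
      (hasDerivAt_integral_of_dominated_loc_of_deriv_le
        (μ := volume.restrict (Ioi (0:ℝ)))
        (F := fun (v : ℂ) (x : ℝ) => (x : ℂ) ^ (s - 1) * exp (-v * x))
        (F' := fun (v : ℂ) (x : ℝ) => (x : ℂ) ^ (s - 1) * (exp (-v * x) * (-1 * x)))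
        (bound := fun x => x ^ s.re * Real.exp (-(v.re / 2) * x)) hmem
        (Eventually.of_forall fun z => (continuousOn_cpow_mul_exp_neg _ z).aestronglyMeasurable
          measurableSet_Ioi)
        (integrableOn_Ioi_zero_cpow_mul_exp_neg hv0 (by simp [hs])) ?_ ?_
        (integrableOn_Ioi_zero_rpow_mul_exp_neg (by positivity) (by linarith)) ?_).2)
    · refine ContinuousOn.aestronglyMeasurable (fun x hx => ?_) measurableSet_Ioi
      exact ((continuousAt_ofReal_cpow_const x _ (Or.inr (ne_of_gt hx))).mul
        (by fun_prop)).continuousWithinAt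
    · filter_upwards [ae_restrict_mem measurableSet_Ioi] with x hx z hz
      have hx0 : (0:ℝ) < x := hx
      have hz0 : v.re / 2 < z.re := hz
      rw [← mul_assoc, norm_mul, norm_cpow_mul_exp_neg hx0]
      simp only [sub_re, one_re, norm_mul, norm_neg, norm_one, one_mul, Complex.norm_real,
        Real.norm_of_nonneg hx0.le]
      rw [Real.rpow_sub_one hx0.ne']
      have : x ^ s.re / x * Real.exp (-z.re * x) * x = x ^ s.re * Real.exp (-z.re * x) := by
        field_simp
      rw [this]
      gcongr
    · refine ae_of_all _ fun x z _ => ?_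
      exact ((((hasDerivAt_id z).neg).mul_const (x : ℂ)).cexp).const_mul _
  have hG : DifferentiableOn ℂ (fun v : ℂ => Gamma s * v ^ (-s)) {v : ℂ | 0 < v.re} := by
    intro v hv
    refine DifferentiableAt.differentiableWithinAt ?_
    exact (DifferentiableAt.cpow_const differentiableAt_id (Or.inl hv)).const_mul _
  have hpre : IsPreconnected {v : ℂ | 0 < v.re} := (convex_halfSpace_re_gt 0).isPreconnected
  -- Identity theorem in α: both sides are holomorphic on the right half-plane and agree at positive
  -- reals, which accumulate at 1.
  refine (hF.analyticOnNhd hopen).eqOn_of_preconnected_of_frequently_eq (hG.analyticOnNhd hopen)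
    hpre (z₀ := 1) (by simp) ?_ hα
  have ht : Tendsto (fun x : ℝ => (x : ℂ)) (𝓝[≠] 1) (𝓝[≠] 1) := by
    refine tendsto_nhdsWithin_of_tendsto_nhds_of_eventually_within _ ?_ ?_
    · exact (Complex.continuous_ofReal.tendsto' 1 1 (by simp)).mono_left nhdsWithin_le_nhds
    · filter_upwards [self_mem_nhdsWithin] with x hx
      simpa using hx
  refine ht.frequently (Eventually.frequently ?_)
  filter_upwards [nhdsWithin_le_nhds (Ioi_mem_nhds (zero_lt_one (α := ℝ)))] with x hx
  have hx0 : (0:ℝ) < x := hx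
  have h := Complex.integral_cpow_mul_exp_neg_mul_Ioi hs hx0
  simp only [← neg_mul] at h
  rw [h, one_div, inv_cpow _ _ (by rw [arg_ofReal_of_nonneg hx0.le]; exact Real.pi_pos.ne),
    cpow_neg, mul_comm]

/-! ### Hankel's formula, with the circle in the coordinate log x -/

/-- Contribution of the circle to the Hankel integral of `e ^ (-α x) x ^ (s - 1)`. -/
noncomputable def circlePart (α s : ℂ) (ε : ℝ) : ℂ :=
  ∫ θ in (0 : ℝ)..2 * Real.pi, exp (-α * exp (Real.log ε + θ * I)) * exp (s * (Real.log ε + θ * I))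

/-- Contribution of one side of the real axis. -/
noncomputable def linePart (α s : ℂ) (ε : ℝ) : ℂ :=
  ∫ x in Ioi ε, (x : ℂ) ^ (s - 1) * exp (-α * x)

lemma exp_log_mul {ε : ℝ} (hε : 0 < ε) (s : ℂ) : exp (s * Real.log ε) = (ε : ℂ) ^ s := by
  rw [cpow_def_of_ne_zero (ofReal_ne_zero.mpr hε.ne'), ← ofReal_log hε.le, mul_comm]

/-- Integrate the derivative of x^s e^{-αx} from ε to ∞. -/
lemma linePart_add_one {α : ℂ} (hα : 0 < α.re) {s : ℂ} (hs : s ≠ 0) {ε : ℝ} (hε : 0 < ε) :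
    α * linePart α (s + 1) ε = (ε : ℂ) ^ s * exp (-α * ε) + s * linePart α s ε := by
  have h1 := integrableOn_Ioi_cpow_mul_exp_neg hε hα (s - 1)
  have h2 := integrableOn_Ioi_cpow_mul_exp_neg hε hα s
  have key := integral_Ioi_of_hasDerivAt_of_tendsto' (a := ε) (m := 0)
    (f := fun x : ℝ => (x : ℂ) ^ s * exp (-α * x))
    (f' := fun x : ℝ => s * ((x : ℂ) ^ (s - 1) * exp (-α * x)) - α * ((x : ℂ) ^ s * exp (-α * x)))
    ?_ ((h1.const_mul s).sub (h2.const_mul α)) ?_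
  · rw [integral_sub (h1.const_mul s) (h2.const_mul α), integral_const_mul,
      integral_const_mul] at key
    rw [linePart, linePart, add_sub_cancel_right]
    linear_combination -key
  · intro x hx
    have hx0 : x ≠ 0 := (hε.trans_le hx).ne'
    have hd1 : HasDerivAt (fun y : ℝ => (y : ℂ) ^ s) (s * (x : ℂ) ^ (s - 1)) x := by
      have := (hasDerivAt_ofReal_cpow_const' (r := s - 1) hx0 (by
        intro h; exact hs (by linear_combination h))).mul_const s
      simp only [sub_add_cancel, div_mul_cancel₀ _ hs] at this
      exact this.congr_deriv (by ring)
    have hd2 : HasDerivAt (fun y : ℝ => exp (-α * y)) (exp (-α * x) * (-α * 1)) x :=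
      (((hasDerivAt_id (x : ℂ)).const_mul (-α)).cexp).comp_ofReal
    exact (hd1.mul hd2).congr_deriv (by ring)
  · rw [tendsto_zero_iff_norm_tendsto_zero]
    have := tendsto_rpow_mul_exp_neg_mul_atTop_nhds_zero s.re α.re hα
    refine this.congr' ?_
    filter_upwards [eventually_gt_atTop 0] with x hx
    exact (norm_cpow_mul_exp_neg hx s α).symm

/-- The same total derivative around the circle. The boundary term is the jump of x^s, and it
cancels that of `linePart_add_one` after multiplication by e^{2πis} - 1. -/
lemma circlePart_add_one (α s : ℂ) {ε : ℝ} (hε : 0 < ε) :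
    α * (I * circlePart α (s + 1) ε) = s * (I * circlePart α s ε) -
      (exp (2 * Real.pi * I * s) - 1) * ((ε : ℂ) ^ s * exp (-α * ε)) := by
  have hlog : exp (Real.log ε : ℂ) = ε := by rw [← ofReal_exp, Real.exp_log hε]
  have hc : ∀ s : ℂ, IntervalIntegrable (fun θ : ℝ =>
      exp (-α * exp (Real.log ε + θ * I)) * exp (s * (Real.log ε + θ * I))) volume 0
      (2 * Real.pi) := fun s => (Continuous.intervalIntegrable (by fun_prop) _ _)
  have key := intervalIntegral.integral_eq_sub_of_hasDerivAt (a := 0) (b := 2 * Real.pi)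
    (f := fun θ : ℝ => exp (-α * exp (Real.log ε + θ * I)) * exp (s * (Real.log ε + θ * I)))
    (f' := fun θ : ℝ =>
      s * I * (exp (-α * exp (Real.log ε + θ * I)) * exp (s * (Real.log ε + θ * I))) -
      α * I * (exp (-α * exp (Real.log ε + θ * I)) * exp ((s + 1) * (Real.log ε + θ * I))))
    ?_ (((hc s).const_mul _).sub ((hc (s + 1)).const_mul _))
  · rw [intervalIntegral.integral_sub ((hc s).const_mul _) ((hc (s + 1)).const_mul _),
      intervalIntegral.integral_const_mul, intervalIntegral.integral_const_mul] at key
    rw [← circlePart, ← circlePart] at key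
    have e1 : exp (Real.log ε + ((2 * Real.pi : ℝ) : ℂ) * I) = ε := by
      rw [Complex.exp_add, hlog]; push_cast; rw [Complex.exp_two_pi_mul_I, mul_one]
    have e2 : exp (s * (Real.log ε + ((2 * Real.pi : ℝ) : ℂ) * I)) =
        (ε : ℂ) ^ s * exp (2 * Real.pi * I * s) := by
      rw [← exp_log_mul hε, ← Complex.exp_add]; push_cast; ring_nf
    have e3 : exp (s * (Real.log ε + ((0 : ℝ) : ℂ) * I)) = (ε : ℂ) ^ s := by
      rw [← exp_log_mul hε]; simp
    have e4 : exp (Real.log ε + ((0 : ℝ) : ℂ) * I) = ε := by simp [hlog]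
    rw [e1, e2, e3, e4] at key
    linear_combination -key
  · intro θ _
    have hd0 : HasDerivAt (fun y : ℝ => (Real.log ε : ℂ) + y * I) I θ := by
      simpa using (((hasDerivAt_id (θ : ℂ)).mul_const I).const_add (Real.log ε : ℂ)).comp_ofReal
    have hd := ((hd0.cexp.const_mul (-α)).cexp).mul ((hd0.const_mul s).cexp)
    refine hd.congr_deriv ?_
    rw [add_mul s 1, one_mul, Complex.exp_add (s * _)]
    ring

/-- Cauchy's theorem on the rectangle [log δ, log ε] × [0, 2π]: in w = log x the integrand is
entire, with no branch cut, and its values on the two horizontal sides differ by the factor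
e^{2πis}. -/
lemma circlePart_sub_circlePart (α s : ℂ) {δ ε : ℝ} (hδ : 0 < δ) (hε : δ ≤ ε) :
    I * circlePart α s ε - I * circlePart α s δ =
      (exp (2 * Real.pi * I * s) - 1) * ∫ x in δ..ε, (x : ℂ) ^ (s - 1) * exp (-α * x) := by
  have hε0 := hδ.trans_le hε
  have key := Complex.integral_boundary_rect_eq_zero_of_differentiableOn
    (fun w => exp (-α * exp w) * exp (s * w)) ⟨Real.log δ, 0⟩ ⟨Real.log ε, 2 * Real.pi⟩
    (Differentiable.differentiableOn (by fun_prop))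
  simp only [smul_eq_mul] at key
  rw [← circlePart, ← circlePart] at key
  have e1 : ∀ x : ℝ, exp (-α * exp (x + ((2 * Real.pi : ℝ) : ℂ) * I)) *
      exp (s * (x + ((2 * Real.pi : ℝ) : ℂ) * I)) =
      exp (2 * Real.pi * I * s) * (exp (-α * exp x) * exp (s * x)) := by
    intro x
    rw [Complex.exp_add (x : ℂ), mul_add s, Complex.exp_add (s * x)]
    push_cast
    rw [Complex.exp_two_pi_mul_I, mul_one]
    ring_nf
  simp_rw [e1] at key
  rw [intervalIntegral.integral_const_mul] at key
  simp only [ofReal_zero, zero_mul, add_zero] at key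
  have hsub := intervalIntegral.integral_deriv_smul_comp''
    (a := Real.log δ) (b := Real.log ε) (f := Real.exp) (f' := Real.exp)
    (g := fun x : ℝ => (x : ℂ) ^ (s - 1) * exp (-α * x)) Real.continuous_exp.continuousOn
    (fun x _ => (Real.hasDerivAt_exp x).hasDerivWithinAt) Real.continuous_exp.continuousOn
    ((continuousOn_cpow_mul_exp_neg _ _).mono (by
      rintro _ ⟨x, -, rfl⟩; exact Real.exp_pos x))
  rw [Real.exp_log hδ, Real.exp_log hε0] at hsub
  rw [← hsub]
  have e2 : ∀ x : ℝ, Real.exp x • ((fun x : ℝ => (x : ℂ) ^ (s - 1) * exp (-α * x)) ∘ Real.exp) x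
      = exp (-α * exp x) * exp (s * x) := by
    intro x
    simp only [Function.comp, real_smul]
    rw [← exp_log_mul (Real.exp_pos x), Real.log_exp, ofReal_exp, ← mul_assoc, ← Complex.exp_add,
      mul_comm]
    ring_nf
  simp_rw [e2]
  linear_combination key

lemma norm_circlePart_le (α s : ℂ) {ε : ℝ} (h0 : 0 < ε) (h1 : ε ≤ 1) :
    ‖circlePart α s ε‖ ≤
      Real.exp ‖α‖ * (ε ^ s.re * Real.exp (|s.im| * (2 * Real.pi))) * (2 * Real.pi) := by
  have hpi := Real.pi_pos
  have := intervalIntegral.norm_integral_le_of_norm_le_const (a := 0) (b := 2 * Real.pi)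
    (f := fun θ : ℝ => exp (-α * exp (Real.log ε + θ * I)) * exp (s * (Real.log ε + θ * I)))
    (C := Real.exp ‖α‖ * (ε ^ s.re * Real.exp (|s.im| * (2 * Real.pi)))) ?_
  · rwa [sub_zero, abs_of_pos (by positivity : 0 < 2 * Real.pi)] at this
  · intro θ hθ
    rw [uIoc_of_le (by positivity)] at hθ
    rw [norm_mul]
    gcongr
    · refine (Complex.norm_exp_le_exp_norm _).trans (Real.exp_le_exp.mpr ?_)
      rw [norm_mul, norm_neg, Complex.norm_exp]
      have : (Real.log ε + θ * I : ℂ).re = Real.log ε := by simp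
      rw [this, Real.exp_log h0]
      exact mul_le_of_le_one_right (norm_nonneg _) h1
    · rw [Complex.norm_exp, Real.rpow_def_of_pos h0, ← Real.exp_add]
      apply Real.exp_le_exp.mpr
      have : (s * (Real.log ε + θ * I)).re = Real.log ε * s.re - s.im * θ := by
        simp [mul_comm]
      rw [this]
      have : -(s.im * θ) ≤ |s.im| * (2 * Real.pi) := by
        calc -(s.im * θ) ≤ |s.im * θ| := neg_le_abs _
          _ = |s.im| * θ := by rw [abs_mul, abs_of_pos hθ.1]
          _ ≤ _ := by gcongr; exact hθ.2
      linarith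

/-- Shrink the inner circle in `circlePart_sub_circlePart`: its contribution is O(δ^{Re s}). -/
lemma circlePart_eq_of_re_pos {α s : ℂ} (hα : 0 < α.re) (hs : 0 < s.re) {ε : ℝ} (hε : 0 < ε) :
    I * circlePart α s ε =
      (exp (2 * Real.pi * I * s) - 1) * ∫ x in (0 : ℝ)..ε, (x : ℂ) ^ (s - 1) * exp (-α * x) := by
  set f : ℝ → ℂ := fun x => (x : ℂ) ^ (s - 1) * exp (-α * x)
  have hint : ∀ a b : ℝ, 0 ≤ a → a ≤ b → IntervalIntegrable f volume a b := fun a b ha hab => by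
    rw [intervalIntegrable_iff_integrableOn_Ioc_of_le hab]
    exact (integrableOn_Ioi_zero_cpow_mul_exp_neg hα (by simp [hs])).mono_set
      (fun x hx => ha.trans_lt hx.1)
  have hcont : ContinuousOn (fun x => ∫ t in (0:ℝ)..x, f t) (uIcc 0 ε) := by
    apply intervalIntegral.continuousOn_primitive_interval
    rw [uIcc_of_le hε.le, integrableOn_Icc_iff_integrableOn_Ioc]
    exact (intervalIntegrable_iff_integrableOn_Ioc_of_le hε.le).mp (hint 0 ε le_rfl hε.le)
  have ht1 : Tendsto (fun x => ∫ t in (0:ℝ)..x, f t) (𝓝[>] 0) (𝓝 0) := by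
    have := hcont 0 left_mem_uIcc
    rw [ContinuousWithinAt, intervalIntegral.integral_same, uIcc_of_le hε.le] at this
    refine this.mono_left (nhdsWithin_le_iff.mpr ?_)
    exact mem_of_superset (Ioo_mem_nhdsGT hε) Ioo_subset_Icc_self
  have ht2 : Tendsto (fun x => circlePart α s x) (𝓝[>] 0) (𝓝 0) := by
    refine squeeze_zero_norm' (a := fun ε : ℝ => Real.exp ‖α‖ *
      (ε ^ s.re * Real.exp (|s.im| * (2 * Real.pi))) * (2 * Real.pi)) ?_ ?_
    · filter_upwards [Ioo_mem_nhdsGT (zero_lt_one (α := ℝ))] with x hx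
      exact norm_circlePart_le α s hx.1 hx.2.le
    · have : ContinuousAt (fun ε : ℝ => Real.exp ‖α‖ *
          (ε ^ s.re * Real.exp (|s.im| * (2 * Real.pi))) * (2 * Real.pi)) 0 := by
        have := Real.continuousAt_rpow_const 0 s.re (Or.inr hs.le)
        fun_prop
      have h := this.tendsto.mono_left (nhdsWithin_le_nhds (s := Ioi 0))
      simpa [Real.zero_rpow hs.ne'] using h
  set c := exp (2 * Real.pi * I * s) - 1
  have ht : Tendsto (fun x => I * circlePart α s x - c * ∫ t in (0:ℝ)..x, f t) (𝓝[>] 0) (𝓝 0) := by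
    simpa using (ht2.const_mul I).sub (ht1.const_mul c)
  have hconst : Tendsto (fun x => I * circlePart α s x - c * ∫ t in (0:ℝ)..x, f t) (𝓝[>] 0)
      (𝓝 (I * circlePart α s ε - c * ∫ t in (0:ℝ)..ε, f t)) := by
    refine tendsto_const_nhds.congr' ?_
    filter_upwards [Ioo_mem_nhdsGT hε] with x hx
    have h1 := circlePart_sub_circlePart α s hx.1 hx.2.le
    have h2 := intervalIntegral.integral_add_adjacent_intervals (hint 0 x le_rfl hx.1.le)
      (hint x ε hx.1.le hx.2.le)
    rw [← h2]
    linear_combination h1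
  exact sub_eq_zero.mp (tendsto_nhds_unique hconst ht)

lemma hankel_parts_of_re_pos {α s : ℂ} (hα : 0 < α.re) (hs : 0 < s.re) {ε : ℝ} (hε : 0 < ε) :
    (exp (2 * Real.pi * I * s) - 1) * linePart α s ε + I * circlePart α s ε =
      (exp (2 * Real.pi * I * s) - 1) * (Gamma s * α ^ (-s)) := by
  have hint := integrableOn_Ioi_zero_cpow_mul_exp_neg hα (s := s - 1) (by simp [hs])
  rw [circlePart_eq_of_re_pos hα hs hε, ← mul_add, ← integral_cpow_mul_exp_neg_mul_complex hα hs,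
    linePart, intervalIntegral.integral_of_le hε.le, add_comm, ← setIntegral_union
      (Ioc_disjoint_Ioi le_rfl) measurableSet_Ioi (hint.mono_set fun x hx => hx.1)
      (hint.mono_set fun x hx => hε.trans hx), Ioc_union_Ioi_eq_Ioi hε.le]

/-- **Hankel's formula**: the sum of the contributions of the circle and the two sides of the
real axis. -/
lemma hankel_parts {α s : ℂ} (hα : 0 < α.re) (hs : ∀ n : ℤ, s ≠ n) {ε : ℝ} (hε : 0 < ε) :
    (exp (2 * Real.pi * I * s) - 1) * linePart α s ε + I * circlePart α s ε =
      (exp (2 * Real.pi * I * s) - 1) * (Gamma s * α ^ (-s)) := by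
  obtain ⟨N, hN⟩ : ∃ N : ℕ, -(N : ℝ) < s.re := by
    obtain ⟨N, hN⟩ := exists_nat_gt (-s.re)
    exact ⟨N, by linarith⟩
  -- Both sides F satisfy α F(s+1) = s F(s), so the formula descends from Re s > 0 one unit at a
  -- time; s ≠ 0 allows the division.
  induction N generalizing s with
  | zero => exact hankel_parts_of_re_pos hα (by simpa using hN) hε
  | succ N ih =>
    have hs0 : s ≠ 0 := by simpa using hs 0
    have hα0 : α ≠ 0 := fun h => by simp [h] at hα
    have h := ih (s := s + 1) (fun n hn => hs (n - 1) (by push_cast; rw [← hn]; ring)) (by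
      push_cast at hN; simp only [add_re, one_re]; linarith)
    have h1 := linePart_add_one hα hs0 hε
    have h2 := circlePart_add_one α s hε
    have e1 : exp (2 * Real.pi * I * (s + 1)) = exp (2 * Real.pi * I * s) := by
      rw [mul_add, mul_one, Complex.exp_add, Complex.exp_two_pi_mul_I, mul_one]
    have e2 : α * α ^ (-(s + 1)) = α ^ (-s) := by
      rw [show -s = 1 + -(s + 1) by ring, cpow_add _ _ hα0, cpow_one]
    rw [e1, Gamma_add_one s hs0] at h
    apply mul_left_cancel₀ hs0
    linear_combination α * h - (exp (2 * Real.pi * I * s) - 1) * h1 - h2 +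
      (exp (2 * Real.pi * I * s) - 1) * s * Gamma s * e2

/-! ### The parametrised contour -/

/-- The one-variable factor `x ^ (s - 1) dx` of the pulled-back integrand. -/
noncomputable def hankelWeight (ε : ℝ) (s : ℂ) (u : ℝ) : ℂ :=
  hankelPow ε u (s - 1) * hankelVelocity ε u

@[fun_prop]
lemma measurable_hankelRadius (ε : ℝ) : Measurable (hankelRadius ε) := by
  unfold hankelRadius
  exact Measurable.ite measurableSet_Iio (by fun_prop)
    (Measurable.ite measurableSet_Iic (by fun_prop) (by fun_prop))

@[fun_prop]
lemma measurable_hankelArg : Measurable hankelArg := by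
  unfold hankelArg
  exact Measurable.ite measurableSet_Iio (by fun_prop)
    (Measurable.ite measurableSet_Iic (by fun_prop) (by fun_prop))

@[fun_prop]
lemma measurable_hankelPoint (ε : ℝ) : Measurable (hankelPoint ε) := by
  unfold hankelPoint; fun_prop

@[fun_prop]
lemma measurable_hankelWeight (ε : ℝ) (s : ℂ) : Measurable (hankelWeight ε s) := by
  unfold hankelWeight hankelPow hankelVelocity
  refine Measurable.mul (by fun_prop) ?_
  exact Measurable.ite measurableSet_Iio (by fun_prop)
    (Measurable.ite measurableSet_Iic (by fun_prop) (by fun_prop))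

lemma hankelPoint_of_neg {ε u : ℝ} (hu : u < 0) : hankelPoint ε u = ((ε - u : ℝ) : ℂ) := by
  simp [hankelPoint, hankelRadius, hankelArg, hu]

lemma hankelPoint_of_mem {ε u : ℝ} (hu : u ∈ Icc 0 (2 * Real.pi)) :
    hankelPoint ε u = ε * exp (I * u) := by
  simp [hankelPoint, hankelRadius, hankelArg, hu.1.not_gt, hu.2]

lemma hankelPoint_of_gt {ε u : ℝ} (hu : 2 * Real.pi < u) :
    hankelPoint ε u = ((ε + (u - 2 * Real.pi) : ℝ) : ℂ) := by
  have hu0 : ¬ u < 0 := by linarith [Real.pi_pos]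
  have : exp (I * (2 * Real.pi)) = 1 := by rw [mul_comm, Complex.exp_two_pi_mul_I]
  simp [hankelPoint, hankelRadius, hankelArg, hu0, hu.not_ge, this]

lemma hankelRadius_of_mem {ε u : ℝ} (hu : u ∈ Icc 0 (2 * Real.pi)) : hankelRadius ε u = ε := by
  simp [hankelRadius, hu.1.not_gt, hu.2]

lemma hankelRadius_of_gt {ε u : ℝ} (hu : 2 * Real.pi < u) :
    hankelRadius ε u = ε + (u - 2 * Real.pi) := by
  have hu0 : ¬ u < 0 := by linarith [Real.pi_pos]
  simp [hankelRadius, hu0, hu.not_ge]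

lemma hankelRadius_of_neg {ε u : ℝ} (hu : u < 0) : hankelRadius ε u = ε - u := by
  simp [hankelRadius, hu]

lemma hankelWeight_of_neg {ε u : ℝ} (hε : 0 < ε) (hu : u < 0) (s : ℂ) :
    hankelWeight ε s u = -((ε - u : ℝ) : ℂ) ^ (s - 1) := by
  rw [← exp_log_mul (by linarith)]
  simp [hankelWeight, hankelPow, hankelVelocity, hankelRadius, hankelArg, hu]

lemma hankelWeight_of_mem {ε u : ℝ} (hε : 0 < ε) (hu : u ∈ Icc 0 (2 * Real.pi)) (s : ℂ) :
    hankelWeight ε s u = I * exp (s * (Real.log ε + u * I)) := by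
  have hlog : (ε : ℂ) = exp (Real.log ε : ℂ) := by rw [← ofReal_exp, Real.exp_log hε]
  simp only [hankelWeight, hankelPow, hankelVelocity, hankelRadius, hankelArg, hu.1.not_gt, hu.2,
    if_true, if_false]
  rw [show I * (ε : ℂ) * exp (I * u) = I * exp (Real.log ε + I * u) by
    rw [Complex.exp_add, ← hlog, mul_assoc], mul_left_comm, ← Complex.exp_add]
  ring_nf

lemma hankelWeight_of_gt {ε u : ℝ} (hε : 0 < ε) (hu : 2 * Real.pi < u) (s : ℂ) :
    hankelWeight ε s u =
      exp (2 * Real.pi * I * s) * ((ε + (u - 2 * Real.pi) : ℝ) : ℂ) ^ (s - 1) := by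
  have hu0 : ¬ u < 0 := by linarith [Real.pi_pos]
  rw [← exp_log_mul (by linarith)]
  simp only [hankelWeight, hankelPow, hankelVelocity, hankelRadius, hankelArg, hu0, hu.not_ge,
    if_false, mul_one]
  -- The monodromy of x^{s-1} equals that of x^s.
  have : exp (2 * Real.pi * I * s) = exp ((s - 1) * (I * (2 * Real.pi : ℝ))) := by
    rw [show (s - 1) * (I * (2 * Real.pi : ℝ)) = 2 * Real.pi * I * s - 2 * Real.pi * I by
      push_cast; ring, Complex.exp_sub, Complex.exp_two_pi_mul_I, div_one]
  rw [this, ← Complex.exp_add]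
  ring_nf

lemma two_pi_pos : 0 < 2 * Real.pi := by positivity

lemma integrable_of_contour_parts {E : Type*} [NormedAddCommGroup E] {f : ℝ → E}
    (h1 : IntegrableOn f (Iio 0)) (h2 : IntegrableOn f (Icc 0 (2 * Real.pi)))
    (h3 : IntegrableOn f (Ioi (2 * Real.pi))) : Integrable f := by
  have h := (h1.union h2).union h3
  have e : Iio 0 ∪ Icc 0 (2 * Real.pi) ∪ Ioi (2 * Real.pi) = univ := by
    rw [Iio_union_Icc_eq_Iic two_pi_pos.le, Iic_union_Ioi]
  rwa [e, integrableOn_univ] at h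

lemma integral_eq_contour_parts {f : ℝ → ℂ} (h : Integrable f) :
    ∫ u, f u = (∫ u in Iio 0, f u) + (∫ u in Icc 0 (2 * Real.pi), f u) +
      ∫ u in Ioi (2 * Real.pi), f u := by
  rw [← setIntegral_union (by
      rw [Set.disjoint_left]; intro x hx hx2; exact absurd hx2.1 (not_le.mpr hx)) measurableSet_Icc
      h.integrableOn h.integrableOn, Iio_union_Icc_eq_Iic two_pi_pos.le,
    ← setIntegral_union (Iic_disjoint_Ioi le_rfl) measurableSet_Ioi
      h.integrableOn h.integrableOn, Iic_union_Ioi, setIntegral_univ]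

lemma integrableOn_Iio_comp_sub {E : Type*} [NormedAddCommGroup E] {h : ℝ → E} {ε : ℝ}
    (hh : IntegrableOn h (Ioi ε)) : IntegrableOn (fun u => h (ε - u)) (Iio 0) := by
  have := ((Measure.measurePreserving_sub_left volume ε).integrableOn_comp_preimage
    (Homeomorph.subLeft ε).measurableEmbedding (s := Ioi ε) (f := h)).mpr hh
  have e : (fun t => ε - t) ⁻¹' Ioi ε = Iio 0 := by ext; simp
  rwa [e] at this

lemma integral_Iio_comp_sub (h : ℝ → ℂ) (ε : ℝ) :
    ∫ u in Iio 0, h (ε - u) = ∫ x in Ioi ε, h x := by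
  rw [← (Measure.measurePreserving_sub_left volume ε).setIntegral_preimage_emb
    (Homeomorph.subLeft ε).measurableEmbedding h (Ioi ε)]
  congr 2
  ext; simp

lemma integrableOn_Ioi_comp_add_sub {E : Type*} [NormedAddCommGroup E] {h : ℝ → E} {ε b : ℝ}
    (hh : IntegrableOn h (Ioi ε)) : IntegrableOn (fun u => h (ε + (u - b))) (Ioi b) := by
  have := ((measurePreserving_add_right volume (ε - b)).integrableOn_comp_preimage
    (Homeomorph.addRight (ε - b)).measurableEmbedding (s := Ioi ε) (f := h)).mpr hh
  convert this using 1
  · ext u; simp only [Function.comp]; congr 1; ring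
  · ext u; simp only [mem_preimage, mem_Ioi]; constructor <;> intro h <;> linarith

lemma integral_Ioi_comp_add_sub (h : ℝ → ℂ) (ε b : ℝ) :
    ∫ u in Ioi b, h (ε + (u - b)) = ∫ x in Ioi ε, h x := by
  rw [← (measurePreserving_add_right volume (ε - b)).setIntegral_preimage_emb
    (Homeomorph.addRight (ε - b)).measurableEmbedding h (Ioi ε)]
  have : (fun x => x + (ε - b)) ⁻¹' Ioi ε = Ioi b := by
    ext u; simp only [mem_preimage, mem_Ioi]; constructor <;> intro h <;> linarith
  rw [this]
  congr 1
  ext u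
  congr 1; ring

lemma integrable_exp_neg_radius_mul_hankelWeight {ε κ : ℝ} (hε : 0 < ε) (hκ : 0 < κ) (s : ℂ) :
    Integrable (fun u : ℝ => Real.exp (-κ * hankelRadius ε u) * ‖hankelWeight ε s u‖) := by
  have hh := integrableOn_Ioi_rpow_mul_exp_neg hε hκ (s.re - 1)
  refine integrable_of_contour_parts ?_ ?_ ?_
  · refine (integrableOn_Iio_comp_sub hh).congr_fun (fun u hu => ?_) measurableSet_Iio
    have hu0 : u < 0 := hu
    simp only
    rw [hankelRadius_of_neg hu0, hankelWeight_of_neg hε hu0, norm_neg,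
      Complex.norm_cpow_eq_rpow_re_of_pos (by linarith), mul_comm]
    simp
  · have hc : Continuous fun u : ℝ =>
        Real.exp (-κ * ε) * ‖I * exp (s * (Real.log ε + u * I))‖ := by fun_prop
    refine (hc.continuousOn.integrableOn_Icc).congr_fun (fun u hu => ?_) measurableSet_Icc
    simp only
    rw [hankelRadius_of_mem hu, hankelWeight_of_mem hε hu]
  · refine IntegrableOn.congr_fun ((integrableOn_Ioi_comp_add_sub (b := 2 * Real.pi) hh).const_mul
      ‖exp (2 * Real.pi * I * s)‖) (fun u hu => ?_) measurableSet_Ioi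
    have hu0 : 2 * Real.pi < u := hu
    rw [hankelRadius_of_gt hu0, hankelWeight_of_gt hε hu0, norm_mul,
      Complex.norm_cpow_eq_rpow_re_of_pos (by linarith)]
    simp only [sub_re, one_re]
    ring

lemma hankelPoint_cases {ε : ℝ} (hε : 0 < ε) (u : ℝ) :
    (hankelPoint ε u = (hankelRadius ε u : ℂ) ∧ ε ≤ hankelRadius ε u) ∨
      (‖hankelPoint ε u‖ = ε ∧ hankelRadius ε u = ε) := by
  rcases lt_or_ge u 0 with h | h
  · left
    rw [hankelPoint_of_neg h, hankelRadius_of_neg h]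
    exact ⟨rfl, by linarith⟩
  · rcases le_or_gt u (2 * Real.pi) with h2 | h2
    · right
      refine ⟨?_, hankelRadius_of_mem ⟨h, h2⟩⟩
      rw [hankelPoint_of_mem ⟨h, h2⟩, mul_comm I, norm_mul, Complex.norm_exp_ofReal_mul_I,
        mul_one, Complex.norm_real, Real.norm_of_nonneg hε.le]
    · left
      rw [hankelPoint_of_gt h2, hankelRadius_of_gt h2]
      exact ⟨rfl, by linarith⟩

lemma hankelPoint_re_ge {ε : ℝ} (hε : 0 < ε) (u : ℝ) : -ε ≤ (hankelPoint ε u).re := by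
  rcases hankelPoint_cases hε u with h | h
  · rw [h.1, ofReal_re]; linarith
  · have := (abs_le.mp (Complex.abs_re_le_norm (hankelPoint ε u))).1
    rwa [h.1] at this

lemma abs_hankelPoint_im_le {ε : ℝ} (hε : 0 < ε) (u : ℝ) : |(hankelPoint ε u).im| ≤ ε := by
  rcases hankelPoint_cases hε u with h | h
  · rw [h.1, ofReal_im]; simpa using hε.le
  · exact (Complex.abs_im_le_norm _).trans h.1.le

/-- The decay rate κ is kept apart from A so that it can be uniform in the frequencies. Only the
circle loses, by a factor e^{ε‖A‖}, which a small ε makes affordable. -/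
lemma norm_exp_neg_mul_hankelPoint_le {ε κ : ℝ} (hε : 0 < ε) (hκ : 0 ≤ κ) {A : ℂ} (hA : κ ≤ A.re)
    (u : ℝ) :
    ‖exp (-A * hankelPoint ε u)‖ ≤
      Real.exp (-κ * hankelRadius ε u) * Real.exp (ε * (‖A‖ + κ)) := by
  rw [← Real.exp_add]
  rcases hankelPoint_cases hε u with h | h
  · rw [h.1, Complex.norm_exp]
    apply Real.exp_le_exp.mpr
    have h1 : (-A * (hankelRadius ε u : ℂ)).re = -(A.re * hankelRadius ε u) := by simp
    have h2 : 0 ≤ ε * (‖A‖ + κ) := by positivity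
    have h3 : κ * hankelRadius ε u ≤ A.re * hankelRadius ε u := by
      gcongr; linarith
    rw [h1]; linarith
  · refine (Complex.norm_exp_le_exp_norm _).trans (Real.exp_le_exp.mpr ?_)
    rw [norm_mul, norm_neg, h.1, h.2]
    linarith

lemma integrable_exp_mul_hankelWeight {ε : ℝ} (hε : 0 < ε) {A : ℂ} (hA : 0 < A.re) (s : ℂ) :
    Integrable (fun u : ℝ => exp (-A * hankelPoint ε u) * hankelWeight ε s u) := by
  refine ((integrable_exp_neg_radius_mul_hankelWeight hε hA s).const_mul
    (Real.exp (ε * (‖A‖ + A.re)))).mono' (Measurable.aestronglyMeasurable (by fun_prop))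
    (ae_of_all _ fun u => ?_)
  rw [norm_mul, ← mul_assoc, mul_comm (Real.exp (ε * _))]
  gcongr
  exact norm_exp_neg_mul_hankelPoint_le hε hA.le le_rfl u

/-- **Hankel's formula** for the parametrised contour. -/
lemma integral_exp_mul_hankelWeight {ε : ℝ} (hε : 0 < ε) {A s : ℂ} (hA : 0 < A.re)
    (hs : ∀ n : ℤ, s ≠ n) :
    ∫ u : ℝ, exp (-A * hankelPoint ε u) * hankelWeight ε s u =
      (exp (2 * Real.pi * I * s) - 1) * Gamma s * A ^ (-s) := by
  have h1 : ∫ u in Iio 0, exp (-A * hankelPoint ε u) * hankelWeight ε s u = -linePart A s ε := by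
    rw [linePart, ← integral_Iio_comp_sub, ← integral_neg]
    refine setIntegral_congr_fun measurableSet_Iio fun u hu => ?_
    rw [hankelPoint_of_neg hu, hankelWeight_of_neg hε hu]
    ring
  have h3 : ∫ u in Ioi (2 * Real.pi), exp (-A * hankelPoint ε u) * hankelWeight ε s u =
      exp (2 * Real.pi * I * s) * linePart A s ε := by
    rw [linePart, ← integral_Ioi_comp_add_sub _ ε (2 * Real.pi), ← integral_const_mul]
    refine setIntegral_congr_fun measurableSet_Ioi fun u hu => ?_
    rw [hankelPoint_of_gt hu, hankelWeight_of_gt hε hu]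
    ring
  have h2 : ∫ u in Icc 0 (2 * Real.pi), exp (-A * hankelPoint ε u) * hankelWeight ε s u =
      I * circlePart A s ε := by
    have hlog : exp (Real.log ε : ℂ) = ε := by rw [← ofReal_exp, Real.exp_log hε]
    rw [circlePart, intervalIntegral.integral_of_le two_pi_pos.le, ← integral_Icc_eq_integral_Ioc,
      ← integral_const_mul]
    refine setIntegral_congr_fun measurableSet_Icc fun u hu => ?_
    rw [hankelPoint_of_mem hu, hankelWeight_of_mem hε hu, Complex.exp_add _ (u * I), hlog,
      mul_comm I (u : ℂ)]
    ring
  rw [integral_eq_contour_parts (integrable_exp_mul_hankelWeight hε hA s), h1, h2, h3]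
  linear_combination hankel_parts hA hs hε

/-! ### Sums of frequencies and the entire function -/

variable {r : ℕ}

/-- The partial sums `α₁ + ⋯ + α_k` of the frequencies. -/
noncomputable def frequencySum (t : Fin r → ℝ) (k : Fin r) : ℂ :=
  ∑ j ∈ Finset.Iic k, frequency (t j)

@[fun_prop]
lemma continuous_frequencySum (k : Fin r) : Continuous fun t : Fin r → ℝ => frequencySum t k := by
  unfold frequencySum; fun_prop

lemma half_le_frequencySum_re (t : Fin r → ℝ) (k : Fin r) : 1 / 2 ≤ (frequencySum t k).re := by
  rw [frequencySum, re_sum]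
  calc (1 / 2 : ℝ) = (frequency (t k)).re := (frequency_re _).symm
    _ ≤ _ := Finset.single_le_sum (f := fun j => (frequency (t j)).re)
      (fun j _ => by rw [frequency_re]; norm_num) (Finset.mem_Iic.mpr le_rfl)

lemma norm_frequencySum_le (t : Fin r → ℝ) (k : Fin r) :
    ‖frequencySum t k‖ ≤ ∑ j, ‖frequency (t j)‖ :=
  (norm_sum_le _ _).trans
    (Finset.sum_le_sum_of_subset_of_nonneg (Finset.subset_univ _) fun _ _ _ => norm_nonneg _)

lemma frequencySum_mem_slitPlane (t : Fin r → ℝ) (k : Fin r) : frequencySum t k ∈ slitPlane :=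
  Or.inl (by linarith [half_le_frequencySum_re t k])

@[fun_prop]
lemma continuous_log_frequencySum (k : Fin r) :
    Continuous fun t : Fin r → ℝ => log (frequencySum t k) :=
  (continuous_frequencySum k).clog fun t => frequencySum_mem_slitPlane t k

/-- The logarithm grows more slowly than any η‖A‖, and A stays away from its singularity at 0. -/
lemma norm_log_le_of_half_le_re {η : ℝ} (hη : 0 < η) {A : ℂ} (hA : 1 / 2 ≤ A.re) :
    ‖log A‖ ≤ η * ‖A‖ + (|Real.log η| + 1 + Real.pi) := by
  have hA2 : 1 / 2 ≤ ‖A‖ := hA.trans (Complex.re_le_norm A)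
  have hA0 : 0 < ‖A‖ := by linarith
  have h1 : ‖log A‖ ≤ |Real.log ‖A‖| + Real.pi := by
    have : log A = (Real.log ‖A‖ : ℂ) + (arg A : ℂ) * I := rfl
    rw [this]
    refine (norm_add_le _ _).trans ?_
    rw [norm_mul, norm_I, mul_one, Complex.norm_real, Complex.norm_real, Real.norm_eq_abs,
      Real.norm_eq_abs]
    gcongr
    exact Complex.abs_arg_le_pi A
  have h2 : |Real.log ‖A‖| ≤ η * ‖A‖ + (|Real.log η| + 1) := by
    have hp : 0 < η * ‖A‖ := by positivity
    rw [abs_le]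
    constructor
    · have : Real.log (1 / 2) ≤ Real.log ‖A‖ := Real.log_le_log (by norm_num) hA2
      rw [one_div, Real.log_inv] at this
      linarith [Real.log_two_lt_d9, abs_nonneg (Real.log η)]
    · have h3 := Real.log_le_sub_one_of_pos hp
      rw [Real.log_mul hη.ne' hA0.ne'] at h3
      linarith [neg_abs_le (Real.log η)]
  linarith

/-- This makes the continuation entire: however large N is, the powers A_k^{-s_k} with ‖s‖ ≤ N cost
at most a constant times exp(∑ ‖α_j‖). The η below is chosen so that N r η ≤ 1. -/
lemma exists_sum_norm_log_le (r : ℕ) {N : ℝ} (hN : 0 ≤ N) :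
    ∃ C : ℝ, ∀ t : Fin r → ℝ,
      N * ∑ k, ‖log (frequencySum t k)‖ ≤ C + ∑ j, ‖frequency (t j)‖ := by
  set η : ℝ := 1 / ((N + 1) * (r + 1)) with hη
  have hη0 : 0 < η := by positivity
  refine ⟨N * (r * (|Real.log η| + 1 + Real.pi)), fun t => ?_⟩
  set S := ∑ j, ‖frequency (t j)‖
  have hS : 0 ≤ S := Finset.sum_nonneg fun _ _ => norm_nonneg _
  have h1 : ∑ k, ‖log (frequencySum t k)‖ ≤ r * (η * S + (|Real.log η| + 1 + Real.pi)) := by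
    calc _ ≤ ∑ k : Fin r, (η * S + (|Real.log η| + 1 + Real.pi)) := by
          refine Finset.sum_le_sum fun k _ => ?_
          refine (norm_log_le_of_half_le_re hη0 (half_le_frequencySum_re t k)).trans ?_
          gcongr
          exact norm_frequencySum_le t k
      _ = _ := by simp; ring
  have h2 : N * (r * η) ≤ 1 := by
    rw [hη, mul_one_div, mul_div_assoc', div_le_one (by positivity)]
    nlinarith [Nat.cast_nonneg (α := ℝ) r]
  calc _ ≤ N * (r * (η * S + (|Real.log η| + 1 + Real.pi))) := by gcongr
    _ = N * (r * (|Real.log η| + 1 + Real.pi)) + (N * (r * η)) * S := by ring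
    _ ≤ _ := by gcongr; exact mul_le_of_le_one_left hS h2

lemma integrable_norm_kernelDensity_mul_exp :
    Integrable fun t : ℝ => ‖kernelDensity t‖ * Real.exp ‖frequency t‖ := by
  refine ((integrable_exp_neg_mul_abs (c := 1 / 2) (by norm_num)).const_mul
    (Real.exp (1 / 2))).mono' (Continuous.aestronglyMeasurable (by fun_prop))
    (ae_of_all _ fun t => ?_)
  rw [Real.norm_of_nonneg (by positivity)]
  calc _ ≤ Real.exp (-|t| * (5 / 6)) * Real.exp (1 / 2 + |t| / 6) := by
        gcongr
        · exact norm_kernelDensity_le t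
        · exact norm_frequency_le t
    _ ≤ _ := by
        rw [← Real.exp_add, ← Real.exp_add]
        apply Real.exp_le_exp.mpr
        linarith [abs_nonneg t]

/-- An integrable majorant for all superpositions in `r` variables. -/
noncomputable def majorant (t : Fin r → ℝ) : ℝ :=
  ∏ j, (‖kernelDensity (t j)‖ * Real.exp ‖frequency (t j)‖)

lemma integrable_majorant : Integrable (majorant : (Fin r → ℝ) → ℝ) :=
  Integrable.fintype_prod (f := fun (_ : Fin r) t => ‖kernelDensity t‖ * Real.exp ‖frequency t‖)
    fun _ => integrable_norm_kernelDensity_mul_exp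

/-- The density of the superposition of exponentials that represents
`∏ⱼ bernoulliKernel (yⱼ + a)`. -/
noncomputable def shiftedDensity (a : ℝ) (t : Fin r → ℝ) : ℂ :=
  ∏ j, (exp (-(frequency (t j)) * a) * kernelDensity (t j))

@[fun_prop]
lemma continuous_shiftedDensity (a : ℝ) :
    Continuous (shiftedDensity a : (Fin r → ℝ) → ℂ) := by
  unfold shiftedDensity; fun_prop

/-- Since Re α = 1/2 and a ≥ 0, the shift contributes |e^{-αa}| ≤ 1; hence a majorant free of a. -/
lemma norm_shiftedDensity_mul_exp_le {a : ℝ} (ha : 0 ≤ a) (t : Fin r → ℝ) :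
    ‖shiftedDensity a t‖ * Real.exp (∑ j, ‖frequency (t j)‖) ≤ majorant t := by
  rw [shiftedDensity, norm_prod, Real.exp_sum, ← Finset.prod_mul_distrib, majorant]
  refine Finset.prod_le_prod (fun _ _ => by positivity) fun j _ => ?_
  rw [norm_mul]
  gcongr
  refine mul_le_of_le_one_left (norm_nonneg _) ?_
  rw [Complex.norm_exp, Real.exp_le_one_iff]
  simp [frequency_re, ha]

/-- The exponent `∑ₖ sₖ log (α₁ + ⋯ + αₖ)` as a linear form in `s`. -/
noncomputable def logForm (t : Fin r → ℝ) : (Fin r → ℂ) →L[ℂ] ℂ :=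
  ∑ k, log (frequencySum t k) • ContinuousLinearMap.proj (R := ℂ) (φ := fun _ : Fin r => ℂ) k

lemma logForm_apply (t : Fin r → ℝ) (s : Fin r → ℂ) :
    logForm t s = ∑ k, log (frequencySum t k) * s k := by
  simp [logForm]

@[fun_prop]
lemma continuous_logForm : Continuous (logForm : (Fin r → ℝ) → _) := by
  unfold logForm
  fun_prop

lemma norm_logForm_le (t : Fin r → ℝ) : ‖logForm t‖ ≤ ∑ k, ‖log (frequencySum t k)‖ := by
  refine ContinuousLinearMap.opNorm_le_bound _ (Finset.sum_nonneg fun _ _ => norm_nonneg _)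
    fun s => ?_
  rw [logForm_apply, Finset.sum_mul]
  refine (norm_sum_le _ _).trans (Finset.sum_le_sum fun k _ => ?_)
  rw [norm_mul]
  gcongr
  exact norm_le_pi_norm s k

/-- The entire function `∫ ∏ⱼ φ(tⱼ) e ^ (-αⱼ a) ∏ₖ (α₁ + ⋯ + αₖ) ^ (-sₖ) dt`. -/
noncomputable def entireZeta (r : ℕ) (a : ℝ) (s : Fin r → ℂ) : ℂ :=
  ∫ t : Fin r → ℝ, shiftedDensity a t * exp (-logForm t s)

lemma norm_exp_neg_logForm_le (t : Fin r → ℝ) (s : Fin r → ℂ) :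
    ‖exp (-logForm t s)‖ ≤ Real.exp (‖s‖ * ∑ k, ‖log (frequencySum t k)‖) := by
  refine (Complex.norm_exp_le_exp_norm _).trans (Real.exp_le_exp.mpr ?_)
  rw [norm_neg, mul_comm]
  exact ((logForm t).le_opNorm s).trans (by gcongr; exact norm_logForm_le t)

lemma exists_norm_integrand_le (r : ℕ) {N : ℝ} (hN : 0 ≤ N) :
    ∃ C : ℝ, ∀ a : ℝ, 0 ≤ a → ∀ t : Fin r → ℝ,
      ‖shiftedDensity a t‖ * Real.exp (N * ∑ k, ‖log (frequencySum t k)‖) ≤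
        Real.exp C * majorant t := by
  obtain ⟨C, hC⟩ := exists_sum_norm_log_le r hN
  refine ⟨C, fun a ha t => ?_⟩
  calc _ ≤ ‖shiftedDensity a t‖ * (Real.exp C * Real.exp (∑ j, ‖frequency (t j)‖)) := by
        rw [← Real.exp_add]; gcongr; exact hC t
    _ = Real.exp C * (‖shiftedDensity a t‖ * Real.exp (∑ j, ‖frequency (t j)‖)) := by ring
    _ ≤ _ := by gcongr; exact norm_shiftedDensity_mul_exp_le ha t

lemma differentiable_entireZeta {a : ℝ} (ha : 0 ≤ a) : Differentiable ℂ (entireZeta r a) := by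
  intro s
  -- One extra unit is for the ball of radius 1 around s, the other for the factor `logForm t` in
  -- the derivative, bounded by its exponential.
  obtain ⟨C, hC⟩ := exists_norm_integrand_le r (N := ‖s‖ + 1 + 1) (by positivity)
  have hb : ∀ (t : Fin r → ℝ), ∀ x ∈ Metric.ball s 1,
      ‖shiftedDensity a t‖ * ‖exp (-logForm t x)‖ * Real.exp ‖logForm t‖ ≤
        Real.exp C * majorant t := by
    intro t x hx
    have hx1 : ‖x‖ ≤ ‖s‖ + 1 := by
      have : ‖x‖ ≤ ‖s‖ + ‖x - s‖ := by simpa using norm_add_le s (x - s)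
      have h2 : ‖x - s‖ < 1 := mem_ball_iff_norm.mp hx
      linarith
    refine le_trans ?_ (hC a ha t)
    have hL : 0 ≤ ∑ k, ‖log (frequencySum t k)‖ := Finset.sum_nonneg fun _ _ => norm_nonneg _
    rw [mul_assoc, add_mul _ 1, Real.exp_add, one_mul]
    gcongr
    · refine (norm_exp_neg_logForm_le t x).trans ?_
      gcongr
    · exact norm_logForm_le t
  refine HasFDerivAt.differentiableAt (hasFDerivAt_integral_of_dominated_of_fderiv_le
    (F := fun (x : Fin r → ℂ) t => shiftedDensity a t * exp (-logForm t x))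
    (F' := fun (x : Fin r → ℂ) t => (shiftedDensity a t * exp (-logForm t x)) • -logForm t)
    (bound := fun t => Real.exp C * majorant t)
    (Metric.ball_mem_nhds s one_pos) ?_ ?_ ?_ ?_ (integrable_majorant.const_mul _) ?_)
  · exact Eventually.of_forall fun x => Continuous.aestronglyMeasurable (by fun_prop)
  · refine (integrable_majorant.const_mul (Real.exp C)).mono'
      (Continuous.aestronglyMeasurable (by fun_prop)) (ae_of_all _ fun t => ?_)
    refine le_trans ?_ (hb t s (Metric.mem_ball_self one_pos))
    rw [norm_mul]
    exact le_mul_of_one_le_right (by positivity) (Real.one_le_exp (norm_nonneg _))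
  · exact Continuous.aestronglyMeasurable (by fun_prop)
  · refine ae_of_all _ fun t x hx => le_trans ?_ (hb t x hx)
    rw [norm_smul, norm_mul, norm_neg]
    gcongr
    linarith [Real.add_one_le_exp ‖logForm t‖]
  · refine ae_of_all _ fun t x _ => ?_
    have := ((logForm t).hasFDerivAt (x := x)).neg.cexp.const_mul (shiftedDensity a t)
    refine this.congr_fderiv ?_
    rw [smul_smul]
    rfl

lemma tendsto_entireZeta (s : Fin r → ℂ) :
    Tendsto (fun a : ℝ => entireZeta r a s) (𝓝[≥] 0) (𝓝 (entireZeta r 0 s)) := by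
  obtain ⟨C, hC⟩ := exists_norm_integrand_le r (norm_nonneg s)
  refine tendsto_integral_filter_of_dominated_convergence (fun t => Real.exp C * majorant t)
    (Eventually.of_forall fun x => Continuous.aestronglyMeasurable (by fun_prop)) ?_
    (integrable_majorant.const_mul _) (ae_of_all _ fun t => ?_)
  · filter_upwards [self_mem_nhdsWithin] with a ha
    refine ae_of_all _ fun t => le_trans ?_ (hC a ha t)
    rw [norm_mul]
    gcongr
    exact norm_exp_neg_logForm_le t s
  · refine Tendsto.mono_left ?_ nhdsWithin_le_nhds
    refine Continuous.tendsto (f := fun a : ℝ => shiftedDensity a t * exp (-logForm t s)) ?_ 0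
    unfold shiftedDensity
    fun_prop

/-! ### Decoupling the contour variables and Fubini -/

/-- The sum `x_j + ⋯ + x_r` of points of the contour. -/
noncomputable def tailSum (ε : ℝ) (u : Fin r → ℝ) (j : Fin r) : ℂ :=
  ∑ k ∈ Finset.Ici j, hankelPoint ε (u k)

lemma card_mul_le {r : ℕ} {ε : ℝ} (hε : SmallRadius r ε) (s : Finset (Fin r)) :
    (s.card : ℝ) * ε < 1 := by
  have : (s.card : ℝ) ≤ r := by exact_mod_cast card_finset_fin_le s
  exact (mul_le_mul_of_nonneg_right this hε.1.le).trans_lt hε.2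

/-- Each of at most r terms has |Im| ≤ ε, and rε < 1. The superposition is valid for |Im w| < 2,
which leaves room for c y_j with c ≤ 3/2. -/
lemma abs_tailSum_im_lt {ε : ℝ} (hε : SmallRadius r ε) (u : Fin r → ℝ) (j : Fin r) :
    |(tailSum ε u j).im| < 1 := by
  rw [tailSum, im_sum]
  refine lt_of_le_of_lt ?_ (card_mul_le hε (Finset.Ici j))
  refine (Finset.abs_sum_le_sum_abs _ _).trans ?_
  rw [← nsmul_eq_mul]
  exact Finset.sum_le_card_nsmul _ _ _ fun k _ => abs_hankelPoint_im_le hε.1 _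

lemma neg_one_lt_tailSum_re {ε : ℝ} (hε : SmallRadius r ε) (u : Fin r → ℝ) (j : Fin r) :
    -1 < (tailSum ε u j).re := by
  rw [tailSum, re_sum]
  have h := Finset.card_nsmul_le_sum (Finset.Ici j) (fun k => (hankelPoint ε (u k)).re) (-ε)
    fun k _ => hankelPoint_re_ge hε.1 _
  rw [nsmul_eq_mul] at h
  linarith [card_mul_le hε (Finset.Ici j)]

/-- The exchange of summation that turns ∑ α_j y_j into ∑ A_k x_k. -/
lemma sum_mul_sum_Ici {R : Type*} [CommSemiring R] (a x : Fin r → R) :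
    ∑ j, a j * ∑ k ∈ Finset.Ici j, x k = ∑ k, (∑ j ∈ Finset.Iic k, a j) * x k := by
  simp_rw [Finset.mul_sum, Finset.sum_mul]
  exact Finset.sum_comm' fun i j => by simp

/-- The superposition of products of one-variable integrands. -/
noncomputable def superposition (ε a : ℝ) (s : Fin r → ℂ) (u t : Fin r → ℝ) : ℂ :=
  shiftedDensity a t *
    ∏ k, (exp (-frequencySum t k * hankelPoint ε (u k)) * hankelWeight ε (s k) (u k))

lemma hankelIntegrand_eq_integral {ε a : ℝ} (hε : SmallRadius r ε) (s : Fin r → ℂ)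
    (u : Fin r → ℝ) :
    hankelIntegrand r (fun y => bernoulliKernel (y + a)) ε s u =
      ∫ t : Fin r → ℝ, superposition ε a s u t := by
  have h1 : ∀ j, bernoulliKernel (tailSum ε u j + a) =
      ∫ t : ℝ, exp (-(frequency t) * (tailSum ε u j + a)) * kernelDensity t := fun j => by
    rw [integral_exp_mul_kernelDensity]
    simp only [add_im, ofReal_im, add_zero]
    linarith [abs_tailSum_im_lt hε u j]
  have h2 : ∏ j, bernoulliKernel (tailSum ε u j + a) =
      ∫ t : Fin r → ℝ, shiftedDensity a t *
        ∏ k, exp (-frequencySum t k * hankelPoint ε (u k)) := by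
    simp_rw [h1]
    rw [← integral_fintype_prod_volume_eq_prod (fun (j : Fin r) (t : ℝ) =>
      exp (-(frequency t) * (tailSum ε u j + a)) * kernelDensity t)]
    congr 1
    ext t
    have h3 : ∏ k, exp (-frequencySum t k * hankelPoint ε (u k)) =
        ∏ j, exp (-(frequency (t j)) * tailSum ε u j) := by
      simp_rw [neg_mul]
      rw [← Complex.exp_sum, ← Complex.exp_sum, Finset.sum_neg_distrib, Finset.sum_neg_distrib]
      congr 2
      exact (sum_mul_sum_Ici (fun j => frequency (t j)) (fun k => hankelPoint ε (u k))).symm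
    rw [h3, shiftedDensity, ← Finset.prod_mul_distrib]
    refine Finset.prod_congr rfl fun j _ => ?_
    rw [mul_add, Complex.exp_add]
    ring
  have h4 : hankelIntegrand r (fun y => bernoulliKernel (y + a)) ε s u =
      (∏ j, bernoulliKernel (tailSum ε u j + a)) * ∏ k, hankelWeight ε (s k) (u k) := rfl
  rw [h4, h2, ← integral_mul_const]
  congr 1
  ext t
  rw [superposition, Finset.prod_mul_distrib, mul_assoc]

/-- An integrable majorant in the contour parameters. -/
noncomputable def contourMajorant (κ ε : ℝ) (s : Fin r → ℂ) (u : Fin r → ℝ) : ℝ :=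
  ∏ k, (Real.exp (-κ * hankelRadius ε (u k)) * ‖hankelWeight ε (s k) (u k)‖)

lemma integrable_contourMajorant {κ ε : ℝ} (hκ : 0 < κ) (hε : 0 < ε) (s : Fin r → ℂ) :
    Integrable (contourMajorant κ ε s) :=
  Integrable.fintype_prod (f := fun (k : Fin r) u =>
    Real.exp (-κ * hankelRadius ε u) * ‖hankelWeight ε (s k) u‖)
    fun k => integrable_exp_neg_radius_mul_hankelWeight hε hκ (s k)

lemma norm_superposition_le {ε a : ℝ} (hε : SmallRadius r ε) (ha : 0 ≤ a) (s : Fin r → ℂ)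
    (u t : Fin r → ℝ) :
    ‖superposition ε a s u t‖ ≤
      Real.exp (1 / 2) * (contourMajorant (1 / 2) ε s u * majorant t) := by
  have hε0 := hε.1
  set S := ∑ j, ‖frequency (t j)‖
  have hS : 0 ≤ S := Finset.sum_nonneg fun _ _ => norm_nonneg _
  have h1 : ∏ k, ‖exp (-frequencySum t k * hankelPoint ε (u k)) * hankelWeight ε (s k) (u k)‖ ≤
      (∏ k : Fin r, Real.exp (ε * (S + 1 / 2))) * contourMajorant (1 / 2) ε s u := by
    rw [contourMajorant, ← Finset.prod_mul_distrib]
    refine Finset.prod_le_prod (fun _ _ => norm_nonneg _) fun k _ => ?_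
    rw [norm_mul, ← mul_assoc, mul_comm (Real.exp (ε * _))]
    gcongr
    refine (norm_exp_neg_mul_hankelPoint_le hε0 (by norm_num)
      (half_le_frequencySum_re t k) (u k)).trans ?_
    gcongr
    exact norm_frequencySum_le t k
  -- Here rε < 1 is decisive: the losses on the r circles total at most e^{S + 1/2}, and `majorant`
  -- has e^S in reserve.
  have h2 : ∏ k : Fin r, Real.exp (ε * (S + 1 / 2)) ≤ Real.exp (1 / 2) * Real.exp S := by
    rw [← Real.exp_sum, ← Real.exp_add]
    apply Real.exp_le_exp.mpr
    simp only [Finset.sum_const, Finset.card_univ, Fintype.card_fin, nsmul_eq_mul]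
    nlinarith [hε.2]
  have h3 : 0 ≤ contourMajorant (1 / 2) ε s u := Finset.prod_nonneg fun _ _ => by positivity
  rw [superposition, norm_mul, norm_prod]
  calc _ ≤ ‖shiftedDensity a t‖ * ((Real.exp (1 / 2) * Real.exp S) *
        contourMajorant (1 / 2) ε s u) := by
        gcongr
        exact h1.trans (by gcongr)
    _ = Real.exp (1 / 2) * (contourMajorant (1 / 2) ε s u *
        (‖shiftedDensity a t‖ * Real.exp S)) := by ring
    _ ≤ _ := by gcongr; exact norm_shiftedDensity_mul_exp_le ha t

lemma integrable_superposition {ε a : ℝ} (hε : SmallRadius r ε) (ha : 0 ≤ a) (s : Fin r → ℂ) :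
    Integrable (Function.uncurry (superposition ε a s)) (volume.prod volume) := by
  refine (((integrable_contourMajorant (κ := 1 / 2) (by norm_num) hε.1 s).mul_prod
    (integrable_majorant (r := r))).const_mul (Real.exp (1 / 2))).mono' ?_
    (ae_of_all _ fun z => norm_superposition_le hε ha s z.1 z.2)
  refine Measurable.aestronglyMeasurable ?_
  have h1 : Measurable (shiftedDensity a : (Fin r → ℝ) → ℂ) :=
    (continuous_shiftedDensity a).measurable
  have h2 : ∀ k, Measurable fun t : Fin r → ℝ => frequencySum t k := fun k =>
    (continuous_frequencySum k).measurable
  unfold superposition Function.uncurry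
  refine (h1.comp measurable_snd).mul (Finset.measurable_prod _ fun k _ => ?_)
  have h3 : Measurable fun z : (Fin r → ℝ) × (Fin r → ℝ) => frequencySum z.2 k :=
    (h2 k).comp measurable_snd
  fun_prop

lemma integrable_hankelIntegrand {ε a : ℝ} (hε : SmallRadius r ε) (ha : 0 ≤ a)
    (s : Fin r → ℂ) :
    Integrable (hankelIntegrand r (fun y => bernoulliKernel (y + a)) ε s) := by
  refine (integrable_superposition hε ha s).integral_prod_left.congr (ae_of_all _ fun u => ?_)
  exact (hankelIntegrand_eq_integral hε s u).symm

lemma integral_superposition {ε a : ℝ} (hε : 0 < ε) {s : Fin r → ℂ} (hs : NonInteger s)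
    (t : Fin r → ℝ) :
    ∫ u, superposition ε a s u t = shiftedDensity a t * exp (-logForm t s) *
      ∏ k, ((exp (2 * Real.pi * I * s k) - 1) * Gamma (s k)) := by
  unfold superposition
  rw [integral_const_mul, integral_fintype_prod_volume_eq_prod (fun (k : Fin r) (u : ℝ) =>
    exp (-frequencySum t k * hankelPoint ε u) * hankelWeight ε (s k) u)]
  have h : ∀ k, ∫ u, exp (-frequencySum t k * hankelPoint ε u) * hankelWeight ε (s k) u =
      (exp (2 * Real.pi * I * s k) - 1) * Gamma (s k) *
        exp (-(log (frequencySum t k) * s k)) := fun k => by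
    rw [integral_exp_mul_hankelWeight hε (by linarith [half_le_frequencySum_re t k]) (hs k),
      cpow_def_of_ne_zero (slitPlane_ne_zero (frequencySum_mem_slitPlane t k)), mul_neg]
  simp_rw [h]
  rw [Finset.prod_mul_distrib, ← Complex.exp_sum, Finset.sum_neg_distrib, logForm_apply]
  ring

lemma hankelFactor_mul_prod {s : Fin r → ℂ} (hs : NonInteger s) :
    hankelFactor r s * ∏ k, ((exp (2 * Real.pi * I * s k) - 1) * Gamma (s k)) = 1 := by
  rw [hankelFactor, ← Finset.prod_mul_distrib]
  refine Finset.prod_eq_one fun k _ => one_div_mul_cancel (mul_ne_zero ?_ ?_)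
  · rw [sub_ne_zero]
    intro h
    obtain ⟨n, hn⟩ := Complex.exp_eq_one_iff.mp h
    refine hs k n (mul_left_cancel₀ Complex.two_pi_I_ne_zero ?_)
    rw [hn, mul_comm]
  -- `Gamma` takes the value 0 at its poles, so these must be excluded.
  · refine Complex.Gamma_ne_zero fun m hm => hs k (-m) ?_
    rw [hm]; push_cast; rfl

/-- On `(ℂ ∖ ℤ) ^ r` the entire function is given by the Hankel integral. -/
lemma entireZeta_eq {ε a : ℝ} (hε : SmallRadius r ε) (ha : 0 ≤ a) {s : Fin r → ℂ}
    (hs : NonInteger s) :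
    entireZeta r a s =
      hankelFactor r s * hankelIntegral r (fun y => bernoulliKernel (y + a)) ε s := by
  have h : hankelIntegral r (fun y => bernoulliKernel (y + a)) ε s = entireZeta r a s *
      ∏ k, ((exp (2 * Real.pi * I * s k) - 1) * Gamma (s k)) := by
    rw [hankelIntegral, integral_congr_ae (ae_of_all _ fun u => hankelIntegrand_eq_integral hε s u),
      integral_integral_swap (integrable_superposition hε ha s), entireZeta,
      ← integral_mul_const]
    exact integral_congr_ae (ae_of_all _ fun t => integral_superposition hε.1 hs t)
  rw [h]
  linear_combination -entireZeta r a s * hankelFactor_mul_prod hs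

/-! ### The kernel with parameter t -/

/-- With w = y - log t one has t⁻¹e^y = e^w and log t - y = -w; the filled singularity y = log t is
w = 0. -/
lemma hatKernel_eq {t : ℝ} (ht : 0 < t) :
    hatKernel t = fun y => bernoulliKernel (y + ((-Real.log t : ℝ) : ℂ)) := by
  ext y
  have ht0 : (t : ℂ) ≠ 0 := ofReal_ne_zero.mpr ht.ne'
  have he : exp (y + ((-Real.log t : ℝ) : ℂ)) = 1 / t * exp y := by
    rw [Complex.exp_add, ← ofReal_exp, Real.exp_neg, Real.exp_log ht, ofReal_inv, one_div,
      mul_comm]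
  rw [hatKernel, bernoulliKernel, he]
  have hiff : y = (Real.log t : ℂ) ↔ y + ((-Real.log t : ℝ) : ℂ) = 0 := by
    push_cast; rw [← sub_eq_add_neg, sub_eq_zero]
  by_cases h : y = (Real.log t : ℂ)
  · rw [if_pos h, if_pos (hiff.mp h)]
  · rw [if_neg h, if_neg (hiff.not.mp h)]
    push_cast
    ring

lemma isHatDesZeta_entireZeta {t : ℝ} (h0 : 0 < t) (h1 : t < 1) :
    IsHatDesZeta r t (entireZeta r (-Real.log t)) := by
  have ha : 0 ≤ -Real.log t := by linarith [Real.log_neg h0 h1]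
  refine ⟨differentiable_entireZeta ha, fun ε hε s hs => ?_⟩
  rw [hatKernel_eq h0]
  exact ⟨integrable_hankelIntegrand hε ha s, entireZeta_eq hε ha hs⟩

/-! ### The limit c → 1 -/

lemma desKernel_eq_bernoulliGen_sub {c : ℝ} (hc0 : c ≠ 0) {y : ℂ} (hy : y ≠ 0) :
    desKernel c y = (bernoulliGen y - bernoulliGen (c * y)) / y := by
  have hcy : (c : ℂ) * y ≠ 0 := mul_ne_zero (ofReal_ne_zero.mpr hc0) hy
  rw [desKernel, if_neg hy, bernoulliGen, bernoulliGen, if_neg hy, if_neg hcy]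
  field_simp

lemma hasDerivAt_bernoulliGen_mul {v : ℝ} {y : ℂ} (h : |((v : ℂ) * y).im| < 2) :
    HasDerivAt (fun v : ℝ => bernoulliGen (v * y)) (bernoulliKernel (v * y) * (1 * y)) v := by
  have h1 := hasDerivAt_bernoulliGen h
  exact (h1.comp (v : ℂ) ((hasDerivAt_id (v : ℂ)).mul_const y)).comp_ofReal

/-- Mean value inequality for v ↦ g(vy) between c and 1: the derivative is y B(vy), and the factor y
cancels the denominator. -/
lemma exists_norm_desKernel_le : ∃ M : ℝ, 0 < M ∧ ∀ c : ℝ, c ∈ Icc (1 / 2 : ℝ) (3 / 2) → ∀ y : ℂ,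
    |y.im| < 1 → -1 < y.re → ‖desKernel c y‖ ≤ |1 - c| * (M * Real.exp (-(1 / 4) * y.re)) := by
  obtain ⟨M, hM, hb⟩ := exists_norm_bernoulliKernel_le
  have hbound : ∀ v : ℝ, v ∈ Icc (1 / 2 : ℝ) (3 / 2) → ∀ y : ℂ, |y.im| < 1 → -1 < y.re →
      |((v : ℂ) * y).im| < 2 ∧
      ‖bernoulliKernel (v * y)‖ ≤ M * Real.exp 1 * Real.exp (-(1 / 4) * y.re) := by
    intro v hv y him hre
    have hv0 : 0 ≤ v := by linarith [hv.1]
    have h1 : |((v : ℂ) * y).im| < 2 := by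
      rw [im_ofReal_mul, abs_mul, abs_of_nonneg hv0]
      nlinarith [hv.2, abs_nonneg y.im]
    refine ⟨h1, (hb _ h1).trans ?_⟩
    rw [mul_assoc, ← Real.exp_add]
    gcongr
    rw [re_ofReal_mul]
    -- For Re y ≥ 0, v ≥ 1/2 gives the rate 1/4; for -1 < Re y ≤ 0, the constant e absorbs the
    -- difference.
    rcases le_total 0 y.re with h | h
    · nlinarith [hv.1]
    · nlinarith [hv.2]
  refine ⟨M * Real.exp 1, by positivity, fun c hc y him hre => ?_⟩
  by_cases hy : y = 0
  · subst hy
    have h := (hbound 1 (by norm_num) 0 (by simp) (by simp)).2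
    simp only [mul_zero, bernoulliKernel, if_true, norm_div, norm_neg, norm_one] at h
    rw [desKernel, if_pos rfl, norm_div, ← ofReal_one, ← ofReal_sub, Complex.norm_real,
      Real.norm_eq_abs, abs_sub_comm]
    calc |1 - c| / ‖(2 : ℂ)‖ = |1 - c| * (1 / ‖(2 : ℂ)‖) := by ring
      _ ≤ _ := by gcongr
  · have hd : ∀ v ∈ Icc (1 / 2 : ℝ) (3 / 2), HasDerivWithinAt
        (fun v : ℝ => bernoulliGen (v * y)) (bernoulliKernel (v * y) * (1 * y))
        (Icc (1 / 2 : ℝ) (3 / 2)) v := fun v hv =>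
      (hasDerivAt_bernoulliGen_mul (hbound v hv y him hre).1).hasDerivWithinAt
    have h := Convex.norm_image_sub_le_of_norm_hasDerivWithin_le
      (C := M * Real.exp 1 * Real.exp (-(1 / 4) * y.re) * ‖y‖) hd (fun v hv => by
        rw [one_mul, norm_mul]
        gcongr
        exact (hbound v hv y him hre).2) (convex_Icc _ _) hc
        (show (1 : ℝ) ∈ Icc (1 / 2 : ℝ) (3 / 2) by norm_num)
    simp only [ofReal_one, one_mul] at h
    rw [desKernel_eq_bernoulliGen_sub (by linarith [hc.1] : c ≠ 0) hy, norm_div,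
      div_le_iff₀ (norm_pos_iff.mpr hy)]
    refine h.trans (le_of_eq ?_)
    rw [Real.norm_eq_abs]
    ring

/-- For y ≠ 0 the quotient is 1/y times the slope of v ↦ g(vy) at v = 1; at y = 0 it is constantly
-1/2. -/
lemma tendsto_desKernel_div {y : ℂ} (hy : |y.im| < 2) :
    Tendsto (fun c : ℝ => desKernel c y / (1 - c)) (𝓝[≠] 1) (𝓝 (bernoulliKernel y)) := by
  by_cases h0 : y = 0
  · subst h0
    refine tendsto_const_nhds.congr' ?_
    filter_upwards [self_mem_nhdsWithin] with c hc
    have hc1 : (1 : ℂ) - c ≠ 0 := by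
      rw [sub_ne_zero]; exact_mod_cast (Ne.symm hc)
    rw [bernoulliKernel, desKernel, if_pos rfl, if_pos rfl]
    field_simp
    ring
  · have hd : HasDerivAt (fun v : ℝ => bernoulliGen (v * y)) (bernoulliKernel y * (1 * y)) 1 := by
      simpa using hasDerivAt_bernoulliGen_mul (v := 1) (y := y) (by simpa using hy)
    have ht := (hasDerivAt_iff_tendsto_slope.mp hd).div_const y
    rw [one_mul, mul_div_cancel_right₀ _ h0] at ht
    refine ht.congr' ?_
    filter_upwards [self_mem_nhdsWithin,
      nhdsWithin_le_nhds (lt_mem_nhds (zero_lt_one (α := ℝ)))] with c hc hc0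
    have hc1 : (1 : ℂ) - c ≠ 0 := by
      rw [sub_ne_zero]; exact_mod_cast (Ne.symm hc)
    have hc2 : (c : ℂ) - 1 ≠ 0 := by
      rw [← neg_sub]; exact neg_ne_zero.mpr hc1
    rw [desKernel_eq_bernoulliGen_sub (ne_of_gt hc0) h0, slope_def_module, real_smul]
    push_cast
    rw [one_mul]
    field_simp
    ring

lemma measurable_desKernel (c : ℝ) : Measurable (desKernel c) := by
  unfold desKernel
  exact Measurable.ite (measurableSet_singleton 0) (by fun_prop) (by fun_prop)

lemma measurable_hankelIntegrand {K : ℂ → ℂ} (hK : Measurable K) (ε : ℝ) (s : Fin r → ℂ) :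
    Measurable (hankelIntegrand r K ε s) := by
  have h : hankelIntegrand r K ε s = fun u => (∏ j, K (tailSum ε u j)) *
    ∏ k, hankelWeight ε (s k) (u k) := rfl
  rw [h]
  unfold tailSum
  refine (Finset.measurable_prod _ fun j _ => hK.comp ?_).mul
    (Finset.measurable_prod _ fun k _ => by fun_prop)
  exact Finset.measurable_sum _ fun k _ => by fun_prop

/-- Decay in the y_j yields decay in every x_k, because ∑ y_j = ∑ k x_k with all multiplicities at
least 1. On the circle ε < 1 and k Re x_k > -1, so a slack of 2 per variable suffices. -/
lemma sum_hankelRadius_le {ε : ℝ} (hε : SmallRadius r ε) (u : Fin r → ℝ) :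
    ∑ k, hankelRadius ε (u k) - 2 * r ≤ ∑ j, (tailSum ε u j).re := by
  have h1 := sum_mul_sum_Ici (fun _ : Fin r => (1 : ℝ)) (fun k => (hankelPoint ε (u k)).re)
  simp only [one_mul, Finset.sum_const, nsmul_eq_mul, mul_one] at h1
  simp_rw [tailSum, re_sum]
  rw [h1]
  have h2 : ∑ k, (hankelRadius ε (u k) - 2) ≤
      ∑ k, ((Finset.Iic k).card : ℝ) * (hankelPoint ε (u k)).re := by
    refine Finset.sum_le_sum fun k _ => ?_
    have hcard : (1 : ℝ) ≤ ((Finset.Iic k).card : ℝ) := by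
      exact_mod_cast Finset.card_pos.mpr ⟨k, Finset.mem_Iic.mpr le_rfl⟩
    have hle := card_mul_le hε (Finset.Iic k)
    rcases hankelPoint_cases hε.1 (u k) with h | h
    · rw [h.1, ofReal_re]
      nlinarith [hε.1]
    · rw [h.2]
      nlinarith [hankelPoint_re_ge hε.1 (u k), hε.1]
  refine le_trans (le_of_eq ?_) h2
  simp [Finset.sum_sub_distrib, mul_comm]

lemma norm_hankelIntegrand_le {K : ℂ → ℂ} {M : ℝ} (hM : 0 ≤ M)
    (hK : ∀ y : ℂ, |y.im| < 1 → -1 < y.re → ‖K y‖ ≤ M * Real.exp (-(1 / 4) * y.re)) {ε : ℝ}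
    (hε : SmallRadius r ε) (s : Fin r → ℂ) (u : Fin r → ℝ) :
    ‖hankelIntegrand r K ε s u‖ ≤
      M ^ r * Real.exp (r / 2) * contourMajorant (1 / 4) ε s u := by
  have h : hankelIntegrand r K ε s u = (∏ j, K (tailSum ε u j)) *
    ∏ k, hankelWeight ε (s k) (u k) := rfl
  rw [h, norm_mul, norm_prod, norm_prod, contourMajorant, Finset.prod_mul_distrib, ← mul_assoc]
  gcongr
  calc ∏ j, ‖K (tailSum ε u j)‖ ≤ ∏ j : Fin r, (M * Real.exp (-(1 / 4) * (tailSum ε u j).re)) :=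
        Finset.prod_le_prod (fun _ _ => norm_nonneg _) fun j _ =>
          hK _ (abs_tailSum_im_lt hε u j) (neg_one_lt_tailSum_re hε u j)
    _ ≤ _ := by
        rw [Finset.prod_mul_distrib, ← Real.exp_sum, ← Real.exp_sum, ← Finset.mul_sum,
          ← Finset.mul_sum, Finset.prod_const, Finset.card_univ, Fintype.card_fin, mul_assoc,
          ← Real.exp_add]
        gcongr
        linarith [sum_hankelRadius_le hε u]

lemma isDesZeta_entireZeta : IsDesZeta r (entireZeta r 0) := by
  refine ⟨differentiable_entireZeta le_rfl, fun ε hε s hs => ?_⟩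
  obtain ⟨M, hM, hb⟩ := exists_norm_desKernel_le
  have hnear : ∀ᶠ c in 𝓝[≠] (1 : ℝ), c ∈ Icc (1 / 2 : ℝ) (3 / 2) :=
    nhdsWithin_le_nhds (Icc_mem_nhds (by norm_num) (by norm_num))
  have hmaj := integrable_contourMajorant (κ := 1 / 4) (by norm_num) hε.1 s
  constructor
  · filter_upwards [hnear] with c hc
    refine (hmaj.const_mul ((|1 - c| * M) ^ r * Real.exp (r / 2))).mono'
      (measurable_hankelIntegrand (measurable_desKernel c) ε s).aestronglyMeasurable
      (ae_of_all _ fun u => norm_hankelIntegrand_le (by positivity) (fun y h1 h2 => ?_) hε s u)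
    rw [mul_assoc]
    exact hb c hc y h1 h2
  -- The factor (1-c)^{-r} is shared out, one 1/(1-c) per kernel, so that each kernel converges and
  -- stays bounded.
  · have hscale : ∀ (c : ℝ) (u : Fin r → ℝ),
        hankelIntegrand r (fun y => desKernel c y / (1 - c)) ε s u =
          1 / (1 - (c : ℂ)) ^ r * hankelIntegrand r (desKernel c) ε s u := fun c u => by
      simp only [hankelIntegrand, Finset.prod_div_distrib, Finset.prod_const, Finset.card_univ,
        Fintype.card_fin]
      ring
    have hlim : Tendsto (fun c : ℝ => hankelIntegral r (fun y => desKernel c y / (1 - c)) ε s)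
        (𝓝[≠] 1) (𝓝 (hankelIntegral r (fun y => bernoulliKernel (y + (0 : ℝ))) ε s)) := by
      refine tendsto_integral_filter_of_dominated_convergence
        (fun u => M ^ r * Real.exp (r / 2) * contourMajorant (1 / 4) ε s u)
        (Eventually.of_forall fun c => (measurable_hankelIntegrand
          ((measurable_desKernel c).div_const _) ε s).aestronglyMeasurable) ?_
        (hmaj.const_mul _) (ae_of_all _ fun u => ?_)
      · filter_upwards [hnear, self_mem_nhdsWithin] with c hc hc1
        refine ae_of_all _ fun u =>
          norm_hankelIntegrand_le hM.le (fun y h1 h2 => ?_) hε s u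
        have hpos : 0 < |1 - c| := abs_pos.mpr (sub_ne_zero.mpr (Ne.symm hc1))
        rw [norm_div, ← ofReal_one, ← ofReal_sub, Complex.norm_real, Real.norm_eq_abs,
          div_le_iff₀ hpos, mul_comm]
        exact hb c hc y h1 h2
      · refine Tendsto.mul_const _ (tendsto_finsetProd _ fun j _ => ?_)
        simp only [ofReal_zero, add_zero]
        exact tendsto_desKernel_div (by
          have := abs_tailSum_im_lt hε u j
          rw [tailSum] at this
          linarith)
    rw [entireZeta_eq hε le_rfl hs]
    refine (hlim.const_mul (hankelFactor r s)).congr fun c => ?_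
    simp only [hankelIntegral, hscale]
    rw [integral_const_mul]
    ring

end DesMZF

theorem mainTheorem5 (r : ℕ) (hr : 1 ≤ r) :
    ∃ (hatZeta : ℝ → (Fin r → ℂ) → ℂ) (desZeta : (Fin r → ℂ) → ℂ),
      (∀ t : ℝ, 0 < t → t < 1 → DesMZF.IsHatDesZeta r t (hatZeta t)) ∧
      DesMZF.IsDesZeta r desZeta ∧
      ∀ s : Fin r → ℂ,
        Filter.Tendsto (fun t : ℝ => hatZeta t s)
          (nhdsWithin (1 : ℝ) (Set.Iio 1)) (nhds (desZeta s)) := by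
  refine ⟨fun t => DesMZF.entireZeta r (-Real.log t), DesMZF.entireZeta r 0,
    fun t h0 h1 => DesMZF.isHatDesZeta_entireZeta h0 h1, DesMZF.isDesZeta_entireZeta, fun s => ?_⟩
  -- As t → 1 from below, a = -log t tends to 0 through nonnegative values.
  refine (DesMZF.tendsto_entireZeta s).comp
    (tendsto_nhdsWithin_of_tendsto_nhds_of_eventually_within _ ?_ ?_)
  · have h : ContinuousAt (fun t : ℝ => -Real.log t) 1 :=
      (Real.continuousAt_log one_ne_zero).neg
    simpa using h.tendsto.mono_left (nhdsWithin_le_nhds (s := Set.Iio 1))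
  · filter_upwards [self_mem_nhdsWithin,
      nhdsWithin_le_nhds (lt_mem_nhds (zero_lt_one (α := ℝ)))] with t h1 h0
    exact Set.mem_Ici.mpr (by linarith [Real.log_neg h0 h1])
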